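/- **Corollary (Hecke–Bochner formula for the Strichartz Fourier transform).** Let $n\ge 1$ and let $\mathbb H^n=\mathbb C^n\times\mathbb R$ be the Heisenberg group with group law $(z,t)(w,s)=(z+w,\,t+s+\tfrac12\Im(z\cdot\bar w))$ and Lebesgue measure. For $k\in\mathbb N=\{0,1,2,\dots\}$, $d\in\mathbb N$ and $\lambda\neq0$ put $$\varphi^{d}_{k,\lambda}(z)=L^{d}_k(\tfrac12|\lambda||z|^2)\,e^{-\frac14|\lambda||z|^2},\qquad e^{d}_{k,\lambda}(z,t)=e^{i\lambda t}\varphi^{d}_{k,\lambda}(z),$$ where $L_k^d$ is the Laguerre polynomial of type $d$; for negative integers $k$ these functions are $0$. They depend on $z$ only through $|z|$ and are regarded as functions on every $\mathbb H^m$. For $m\ge1$ and $a=(\lambda,(2k+m)|\lambda|)$ with $k\in\mathbb N$, $\lambda\ne0$ (a point of the ray $R_k$ of the Heisenberg fan of $\mathbb H^m$) write $e_a=e^{m-1}_{k,\lambda}$ and $\tilde e_a=\frac{k!\,(m-1)!}{(k+m-1)!}\,e_a$ on $\mathbb H^m$. The Strichartz Fourier transform of $f\in L^1(\mathbb H^n)$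 is $$\hat f(a,z)=\int_{\mathbb H^n}f(w,s)\,e_a\big((w,s)^{-1}(z,0)\big)\,dw\,ds,$$ and the Gelfand transform of a radial function $g(z,t)=g_0(|z|,t)$ on $\mathbb H^m$ is $$\mathcal G_m g(a)=\int_{\mathbb H^m}g(z,t)\,\tilde e_a\big((z,t)^{-1}\big)\,dz\,dt=\int_{\mathbb H^m}g(z,t)\,\overline{\tilde e_a(z,t)}\,dz\,dt ,$$ whenever the integral converges absolutely. A radial function on $\mathbb H^n$ with profile $g_0$ is simultaneously regarded as the radial function with the same profile $g_0$ on every $\mathbb H^m$. Let $P$ be a bigraded solid harmonic of degree $(p,q)$ on $\mathbb C^n$, that is, a harmonic polynomial of the form $P(z)=\sum_{|\alpha|=p}\sum_{|\beta|=q}c_{\alpha,\beta}z^\alpha\bar z^\beta$, and let $f\in L^1(\mathbb H^n)$ be of the form $f(z,t)=P(z)g(z,t)$ (almost everywhere) with $g$ radial. Let $k\in\mathbb N$, $\lambda\ne0$, $a=(\lambda,(2k+n)|\lambda|)$, and write $a(p,q)=(\lambda,(2k+p-q+n)|\lambda|)$, which for $k\ge q$ is the point of the ray $R_{k-q}$ of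 the fan of $\mathbb H^{n+p+q}$ above $\lambda$. Then for all $z\in\mathbb C^n$: * if $\lambda>0$, $$\hat f(a,z)=(2\pi)^{-p-q}|\lambda|^{p+q}\,P(z)\;\mathcal G_{n+p+q}g(a(p,q))\;e^{n+p+q-1}_{k-q,\lambda}(z,0);$$ * if $\lambda<0$, $$\hat f(a,z)=(2\pi)^{-p-q}|\lambda|^{p+q}\,P(z)\;\mathcal G_{n+p+q}g(a(q,p))\;e^{n+p+q-1}_{k-p,\lambda}(z,0).$$ Here, if $P\not\equiv0$, the integral defining $\mathcal G_{n+p+q}g$ at $a(p,q)$ (for $\lambda>0$, $k\ge q$), respectively at $a(q,p)$ (for $\lambda<0$, $k\ge p$), converges absolutely; if $P\equiv0$, or $k<q$ with $\lambda>0$, or $k<p$ with $\lambda<0$, the right-hand side is understood to be $0$. -/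

import Mathlib

open MeasureTheory

noncomputable section

/-- The underlying space `ℂⁿ × ℝ` of the Heisenberg group; its Haar measure is Lebesgue measure
`volume`, and `‖z‖` is the Euclidean norm of `z ∈ ℂⁿ`. -/
abbrev Heis (n : ℕ) : Type := EuclideanSpace ℂ (Fin n) × ℝ

/-- The group law `(z,t)(w,s) = (z + w, t + s + ½ Im (z · w̄))`. -/
def heisMul {n : ℕ} (x y : Heis n) : Heis n :=
  (x.1 + y.1, x.2 + y.2 + (1 / 2) * (∑ j, x.1 j * (starRingEnd ℂ) (y.1 j)).im)

/-- The inverse `(z,t)⁻¹ = (-z,-t)`. -/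
def heisInv {n : ℕ} (x : Heis n) : Heis n := (-x.1, -x.2)

/-- The Laguerre polynomial `L_k^d(x)` of type `d`. -/
def laguerreL (k d : ℕ) (x : ℝ) : ℝ :=
  ∑ j ∈ Finset.range (k + 1),
    (-1) ^ j * (Nat.choose (k + d) (k - j) : ℝ) * x ^ j / (Nat.factorial j : ℝ)

/-- The Laguerre function `φ_{k,λ}^d` as a function of the radius `r = |z|`, with the convention
that it vanishes for negative `k`. -/
def laguerrePhi (d : ℕ) (k : ℤ) (lam r : ℝ) : ℝ :=
  if 0 ≤ k then
    laguerreL k.toNat d ((1 / 2) * |lam| * r ^ 2) * Real.exp (-(1 / 4) * |lam| * r ^ 2)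
  else 0

/-- `e_{k,λ}^d(z,t) = e^{iλt} φ_{k,λ}^d(z)`, as a function of `r = |z|` and `t`. Being radial, it
is at the same time a function on every `Heis m`. -/
def laguerreE (d : ℕ) (k : ℤ) (lam r t : ℝ) : ℂ :=
  Complex.exp (Complex.I * (lam : ℂ) * (t : ℂ)) * (laguerrePhi d k lam r : ℂ)

/-- The ray `R_k`, `k ∈ ℕ`, of the Heisenberg fan of `Heis m`. -/
def fanRay (m k : ℕ) : Set (ℝ × ℝ) := {a | a.2 = (2 * (k : ℝ) + (m : ℝ)) * |a.1|}

open Classical in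
/-- The number `k` of the ray `R_k` through a point `a` of the fan (unique when `a.1 ≠ 0`);
`-1` when there is no such ray. -/
def fanIndex (m : ℕ) (a : ℝ × ℝ) : ℤ :=
  if h : ∃ k : ℕ, a ∈ fanRay m k then (Nat.find h : ℤ) else -1

theorem fanIndex_of_mem {m k : ℕ} {a : ℝ × ℝ} (h0 : a.1 ≠ 0) (ha : a ∈ fanRay m k) :
    fanIndex m a = k := by
  classical
  have h : ∃ k : ℕ, a ∈ fanRay m k := ⟨k, ha⟩
  have huniq : ∀ j : ℕ, a ∈ fanRay m j → j = k := by
    intro j hj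
    have hpos : (0 : ℝ) < |a.1| := abs_pos.mpr h0
    have e : (2 * (j : ℝ) + (m : ℝ)) * |a.1| = (2 * (k : ℝ) + (m : ℝ)) * |a.1| :=
      hj.symm.trans ha
    have e2 := mul_right_cancel₀ hpos.ne' e
    have e3 : (j : ℝ) = (k : ℝ) := by linarith
    exact_mod_cast e3
  unfold fanIndex
  rw [dif_pos h]
  exact congrArg _ (huniq _ (by convert Nat.find_spec h))

/-- `e_a = e_{k,λ}^{m-1}` on `Heis m`, for `a = (λ, (2k+m)|λ|) ∈ R_k` with `λ ≠ 0`. -/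
def fanE (m : ℕ) (a : ℝ × ℝ) (x : Heis m) : ℂ :=
  laguerreE (m - 1) (fanIndex m a) a.1 ‖x.1‖ x.2

/-- The Strichartz Fourier transform
`f̂(a,z) = ∫ f(w,s) e_a((w,s)⁻¹(z,0)) dw ds`, for `a ∈ R_k` with `a.1 ≠ 0`. -/
def strichartzFT (n : ℕ) (f : Heis n → ℂ) (a : ℝ × ℝ) (z : EuclideanSpace ℂ (Fin n)) : ℂ :=
  ∫ x : Heis n, f x * fanE n a (heisMul (heisInv x) (z, 0))

/-- The radial function `(z,t) ↦ g(|z|,t)` on `Heis m` with profile `g`. -/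
def radialFun (m : ℕ) (g : ℝ → ℝ → ℂ) (x : Heis m) : ℂ := g ‖x.1‖ x.2

/-- The bounded spherical function `ẽ_a = k!(m-1)!/(k+m-1)! e_a`, `a ∈ R_k` with `a.1 ≠ 0`. -/
def sphericalE (m : ℕ) (a : ℝ × ℝ) (x : Heis m) : ℂ :=
  ((((fanIndex m a).toNat).factorial * (m - 1).factorial : ℂ) /
    ((((fanIndex m a).toNat) + m - 1).factorial : ℂ)) * fanE m a x

/-- The Gelfand transform
`𝒢_m g(a) = ∫ g(x) ẽ_a(x⁻¹) dx` of a radial function on `Heis m`, `a ∈ R_k` with `a.1 ≠ 0`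
(note `ẽ_a(x⁻¹)` is the complex conjugate of `ẽ_a(x)`). -/
def gelfandT (m : ℕ) (g : Heis m → ℂ) (a : ℝ × ℝ) : ℂ :=
  ∫ x : Heis m, g x * sphericalE m a (heisInv x)

/-- `P` is a bigraded solid harmonic of degree `(p,q)` on `ℂⁿ ≅ ℝ²ⁿ`: a harmonic function of the
form `∑_{|α|=p} ∑_{|β|=q} c_{αβ} z^α z̄^β`. -/
def IsSolidHarmonic {n : ℕ} (p q : ℕ) (P : EuclideanSpace ℂ (Fin n) → ℂ) : Prop :=
  InnerProductSpace.HarmonicOnNhd P Set.univ ∧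
  ∃ c : (Fin n → ℕ) → (Fin n → ℕ) → ℂ, ∀ z : EuclideanSpace ℂ (Fin n),
    P z = ∑ α ∈ Finset.piAntidiag Finset.univ p, ∑ β ∈ Finset.piAntidiag Finset.univ q,
      c α β * (∏ j, z j ^ α j) * ∏ j, (starRingEnd ℂ) (z j) ^ β j

/-- The point `a(p,q) = (λ, (2k+p-q+n)|λ|)`. For `k ≥ q` and `λ ≠ 0` it lies on the ray `R_{k-q}`
of the fan of `Heis (n+p+q)`. -/
def fanShift (n k p q : ℕ) (lam : ℝ) : ℝ × ℝ :=
  (lam, (2 * (k : ℝ) + (p : ℝ) - (q : ℝ) + (n : ℝ)) * |lam|)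

end

/-! Put `κ = |λ|/2`, `A(w) = w · z̄` and `B(w) = w̄ · z`. The Gaussian factor of the kernel
contributes `exp((|λ|/4)(A + B))` and the twist of the group law contributes `exp((λ/4)(B - A))`.
Hence only one of the two exponentials survives, `exp(κB)` for `λ > 0` and `exp(κA)` for `λ < 0`,
multiplied by a Laguerre polynomial in `κ(|z|² + |w|²) - κA - κB` (`fanE_heisMul_heisInv`). The two
signs differ by exchanging `A` with `B` and `p` with `q`.

In polar coordinates `w = rω` the problem becomes an integral over the sphere. The moments `∫ P A^a
B^b dω` vanish unless `a = q + j` and `b = p + j`, and then they are explicit multiples of `|z|^{2j}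
P(z)`. They are computed as Gaussian integrals: integration by parts moves each factor `A` or `B`
onto a derivative, harmonicity removes the mean value, and Euler's identity produces `P(z)`
(`IsGaussHarmonic.gaussInt_mul_pow_mul_pow`, `IsGaussHarmonic.integral_sphere_eq`).

Expanding the exponential and the Laguerre polynomial and inserting these moments leaves a finite
sum over `j` of Laguerre polynomials in `κ|z|² + κr²` (`integral_mul_exp_mul_laguerreSum`). Bailey's
formula (`sum_mul_laguerreSum_eq_mul`) collapses it to a product of `L_{k-q}^{n+p+q-1}` at `κ|z|²`
and at `κr²`. One factor `r^{p+q}` comes from `P(rω)` and another from the moments. Together they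
turn `r^{2n-1} dr` into the radial measure of dimension `2(n+p+q)`, so the remaining integral is the
Gelfand transform on `ℍ^{n+p+q}`. -/

/-! ### Binomial identities and Laguerre polynomials -/

/-- Vandermonde's identity as a sum over a range. -/
theorem choose_add_eq_sum_range (m n k : ℕ) :
    (m + n).choose k = ∑ t ∈ Finset.range (k + 1), m.choose t * n.choose (k - t) := by
  rw [Nat.add_choose_eq, Finset.Nat.sum_antidiagonal_eq_sum_range_succ_mk]

/-- A terminating form of the Pfaff–Saalschütz identity. -/
theorem sum_choose_mul_choose_mul_choose (a b d K : ℕ) :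
    ∑ j ∈ Finset.range (b + 1), a.choose j * (b + d).choose (b - j) * (K + d + j).choose (a + b + d)
      = (K + d).choose (a + d) * K.choose b := by
  -- Vandermonde isolates the dependence on `j` in `j.choose t`. The `j`-sum is then a second
  -- Vandermonde sum, trinomial revision extracts `(K + d).choose (a + d)`, and a third Vandermonde
  -- sum finishes.
  have h1 : ∀ j ∈ Finset.range (b + 1), (K + d + j).choose (a + b + d) =
      ∑ t ∈ Finset.range (b + 1), j.choose t * (K + d).choose (a + b + d - t) := by
    intro j hj
    rw [Finset.mem_range] at hj
    rw [add_comm (K + d) j, choose_add_eq_sum_range]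
    symm
    apply Finset.sum_subset
    · intro t; simp only [Finset.mem_range]; omega
    · intro t _ ht
      rw [Finset.mem_range] at ht
      rw [Nat.choose_eq_zero_of_lt (by omega), zero_mul]
  have h2 : ∀ t ∈ Finset.range (b + 1),
      ∑ j ∈ Finset.range (b + 1), a.choose j * (b + d).choose (b - j) * j.choose t
        = a.choose t * (a + b + d - t).choose (b - t) := by
    intro t ht
    rw [Finset.mem_range] at ht
    by_cases hta : a < t
    · rw [Nat.choose_eq_zero_of_lt hta, zero_mul]
      apply Finset.sum_eq_zero
      intro j _
      rcases lt_or_ge j t with h | h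
      · rw [Nat.choose_eq_zero_of_lt h, mul_zero]
      · rw [Nat.choose_eq_zero_of_lt (by omega : a < j)]; simp
    · have e : a + b + d - t = (a - t) + (b + d) := by omega
      rw [e, choose_add_eq_sum_range (a - t) (b + d) (b - t), Finset.mul_sum]
      have hsub : Finset.Ico t (b + 1) ⊆ Finset.range (b + 1) := by
        intro j; simp only [Finset.mem_Ico, Finset.mem_range]; omega
      rw [← Finset.sum_subset hsub]
      · rw [Finset.sum_Ico_eq_sum_range, show b + 1 - t = b - t + 1 by omega]
        apply Finset.sum_congr rfl
        intro s hs
        have := Nat.choose_mul (n := a) (k := t + s) (s := t) (by omega)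
        rw [show b - (t + s) = b - t - s by omega, mul_right_comm, this,
          show t + s - t = s by omega, mul_assoc]
      · intro j _ hj
        rw [Nat.choose_eq_zero_of_lt (n := j), mul_zero]
        simp only [Finset.mem_Ico, Finset.mem_range] at *
        omega
  have h3 : ∀ t ∈ Finset.range (b + 1),
      a.choose t * (a + b + d - t).choose (b - t) * (K + d).choose (a + b + d - t)
        = (K + d).choose (a + d) * (a.choose t * (K - a).choose (b - t)) := by
    intro t ht
    rw [Finset.mem_range] at ht
    have := Nat.choose_mul (n := K + d) (k := a + b + d - t) (s := a + d) (by omega)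
    rw [← Nat.choose_symm (n := a + b + d - t) (k := b - t) (by omega),
      show a + b + d - t - (b - t) = a + d by omega, mul_assoc,
      mul_comm (Nat.choose _ _) ((K + d).choose _), this,
      show K + d - (a + d) = K - a by omega,
      show a + b + d - t - (a + d) = b - t by omega]
    ring
  calc _ = ∑ j ∈ Finset.range (b + 1), ∑ t ∈ Finset.range (b + 1),
        a.choose j * (b + d).choose (b - j) * (j.choose t * (K + d).choose (a + b + d - t)) := by
        refine Finset.sum_congr rfl fun j hj => ?_
        rw [h1 j hj, Finset.mul_sum]
    _ = ∑ t ∈ Finset.range (b + 1), (∑ j ∈ Finset.range (b + 1),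
        a.choose j * (b + d).choose (b - j) * j.choose t) * (K + d).choose (a + b + d - t) := by
        rw [Finset.sum_comm]
        refine Finset.sum_congr rfl fun t _ => ?_
        rw [Finset.sum_mul]
        refine Finset.sum_congr rfl fun j _ => ?_
        ring
    _ = ∑ t ∈ Finset.range (b + 1),
        (K + d).choose (a + d) * (a.choose t * (K - a).choose (b - t)) := by
        refine Finset.sum_congr rfl fun t ht => ?_
        rw [h2 t ht, h3 t ht]
    _ = (K + d).choose (a + d) * K.choose b := by
        rw [← Finset.mul_sum, ← choose_add_eq_sum_range]
        rcases le_or_gt a K with h | h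
        -- For `a > K` the subtraction `K - a` truncates, but the prefactor `(K + d).choose (a + d)`
        -- is then zero.
        · rw [Nat.add_sub_cancel' h]
        · rw [Nat.choose_eq_zero_of_lt (by omega : K + d < a + d)]; simp

/-- The polynomial `∑ i, (-1)^i C(N, D+i) x^i / i!`; it is the Laguerre polynomial
`L_{N-D}^D` if `D ≤ N`, and `0` otherwise. -/
noncomputable def laguerreSum (N D : ℕ) (x : ℂ) : ℂ :=
  ∑ i ∈ Finset.range (N + 1), (-1) ^ i * (N.choose (D + i) : ℂ) * x ^ i / (i.factorial : ℂ)

theorem laguerreSum_eq_sum_range {N D M : ℕ} (h : N < D + M) (x : ℂ) :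
    laguerreSum N D x =
      ∑ i ∈ Finset.range M, (-1) ^ i * (N.choose (D + i) : ℂ) * x ^ i / (i.factorial : ℂ) := by
  have key : ∀ A B : ℕ, N < D + A → A ≤ B →
      ∑ i ∈ Finset.range A, (-1) ^ i * (N.choose (D + i) : ℂ) * x ^ i / (i.factorial : ℂ) =
      ∑ i ∈ Finset.range B, (-1) ^ i * (N.choose (D + i) : ℂ) * x ^ i / (i.factorial : ℂ) := by
    intro A B hA hAB
    apply Finset.sum_subset
    · intro t; simp only [Finset.mem_range]; omega
    · intro t _ ht
      rw [Finset.mem_range] at ht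
      rw [Nat.choose_eq_zero_of_lt (by omega)]
      simp
  rw [laguerreSum]
  rcases le_total (N + 1) M with h' | h'
  · exact key _ _ (by omega) h'
  · exact (key _ _ h h').symm

theorem ofReal_laguerreL (k d : ℕ) (x : ℝ) :
    (laguerreL k d x : ℂ) = laguerreSum (k + d) d x := by
  rw [laguerreSum_eq_sum_range (M := k + 1) (by omega), laguerreL]
  push_cast
  refine Finset.sum_congr rfl fun j hj => ?_
  rw [Finset.mem_range] at hj
  rw [← Nat.choose_symm (n := k + d) (k := d + j) (by omega),
    show k + d - (d + j) = k - j by omega]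

theorem laguerreSum_eq_zero {N D : ℕ} (h : N < D) (x : ℂ) : laguerreSum N D x = 0 := by
  rw [laguerreSum_eq_sum_range (M := 0) (by omega)]; simp

/-- Taylor expansion of `laguerreSum`. -/
theorem laguerreSum_add {N D M : ℕ} (h : N < D + M) (x y : ℂ) :
    laguerreSum N D (x + y) =
      ∑ i ∈ Finset.range M, (-y) ^ i / (i.factorial : ℂ) * laguerreSum N (D + i) x := by
  rw [laguerreSum_eq_sum_range h]
  have e : ∀ l ∈ Finset.range M,
      (-1) ^ l * (N.choose (D + l) : ℂ) * (x + y) ^ l / (l.factorial : ℂ) =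
      ∑ i ∈ Finset.range (l + 1), (-1) ^ (i + (l - i)) * (N.choose (D + (i + (l - i))) : ℂ) *
        (y ^ i / i.factorial) * (x ^ (l - i) / (l - i).factorial) := by
    intro l _
    rw [add_comm x y, add_pow, Finset.mul_sum, Finset.sum_div]
    refine Finset.sum_congr rfl fun i hi => ?_
    rw [Finset.mem_range] at hi
    rw [Nat.add_sub_cancel' (by omega : i ≤ l), Nat.cast_choose ℂ (by omega : i ≤ l)]
    have := Nat.cast_ne_zero (R := ℂ).mpr l.factorial_ne_zero
    have := Nat.cast_ne_zero (R := ℂ).mpr i.factorial_ne_zero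
    have := Nat.cast_ne_zero (R := ℂ).mpr (l - i).factorial_ne_zero
    field_simp
  rw [Finset.sum_congr rfl e, Finset.sum_range_diag_flip M (fun i j =>
    (-1) ^ (i + j) * (N.choose (D + (i + j)) : ℂ) *
        (y ^ i / i.factorial) * (x ^ j / j.factorial))]
  refine Finset.sum_congr rfl fun i hi => ?_
  rw [Finset.mem_range] at hi
  rw [laguerreSum_eq_sum_range (M := M - i) (by omega), Finset.mul_sum]
  refine Finset.sum_congr rfl fun j _ => ?_
  rw [neg_pow y, pow_add, ← add_assoc]
  ring

/-- Matches the factor `K.choose b` left by the Pfaff–Saalschütz sum with the `y^b` coefficient of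
the normalised Laguerre polynomial in Bailey's formula. -/
theorem choose_mul_factorial_div {K d b : ℕ} :
    (K.factorial : ℂ) / (K + d).factorial * ((K + d).choose (d + b) / b.factorial) =
      K.choose b / (b + d).factorial := by
  have := Nat.cast_ne_zero (R := ℂ).mpr (K + d).factorial_ne_zero
  have := Nat.cast_ne_zero (R := ℂ).mpr b.factorial_ne_zero
  have := Nat.cast_ne_zero (R := ℂ).mpr (b + d).factorial_ne_zero
  have := Nat.cast_ne_zero (R := ℂ).mpr (K - b).factorial_ne_zero
  rcases le_or_gt b K with h | h
  · rw [Nat.cast_choose ℂ h, Nat.cast_choose ℂ (by omega : d + b ≤ K + d),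
      show K + d - (d + b) = K - b by omega, add_comm d b]
    field_simp
  · rw [Nat.choose_eq_zero_of_lt h, Nat.choose_eq_zero_of_lt (by omega)]; simp

/-- Bailey's product formula for Laguerre polynomials. -/
theorem sum_mul_laguerreSum_eq_mul {K d M : ℕ} (hM : K + d < M) (x y : ℂ) :
    ∑ j ∈ Finset.range M, (x * y) ^ j / (j.factorial * (d + j).factorial : ℂ) *
        laguerreSum (K + d + j) (d + 2 * j) (x + y) =
      (K.factorial : ℂ) / (K + d).factorial * laguerreSum (K + d) d x * laguerreSum (K + d) d y := by
  have fne : ∀ l : ℕ, (l.factorial : ℂ) ≠ 0 := fun l => Nat.cast_ne_zero.mpr l.factorial_ne_zero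
  -- Both sides are compared coefficientwise in `x^a y^b`. The shifts `a = j + l`, `b = j + i`
  -- absorb the factor `(xy)^j`, and the added terms with `a < j` or `b < j` carry a vanishing
  -- binomial.
  have e1 : ∀ j ∈ Finset.range M, (x * y) ^ j / (j.factorial * (d + j).factorial : ℂ) *
        laguerreSum (K + d + j) (d + 2 * j) (x + y) =
      ∑ b ∈ Finset.range M, ∑ a ∈ Finset.range M,
        (-1) ^ (a + b) * x ^ a * y ^ b / (a.factorial * (b + d).factorial : ℂ) *
        (a.choose j * (b + d).choose (d + j) * (K + d + j).choose (a + b + d) : ℕ) := by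
    intro j hj
    rw [Finset.mem_range] at hj
    have hsub : Finset.Ico j M ⊆ Finset.range M := by
      intro j; simp only [Finset.mem_Ico, Finset.mem_range]; omega
    rw [laguerreSum_add (M := M - j) (by omega), Finset.mul_sum, ← Finset.sum_subset hsub]
    · rw [Finset.sum_Ico_eq_sum_range]
      refine Finset.sum_congr rfl fun i hi => ?_
      rw [laguerreSum_eq_sum_range (M := M - j) (by omega), Finset.mul_sum, Finset.mul_sum,
        ← Finset.sum_subset hsub]
      · rw [Finset.sum_Ico_eq_sum_range]
        refine Finset.sum_congr rfl fun l hl => ?_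
        push_cast
        rw [Nat.cast_choose ℂ (by omega : j ≤ j + l),
          Nat.cast_choose ℂ (by omega : d + j ≤ j + i + d),
          show j + l - j = l by omega, show j + i + d - (d + j) = i by omega,
          show d + 2 * j + i + l = j + l + (j + i) + d by omega]
        have hs : (-1 : ℂ) ^ (j + l + (j + i)) = (-1) ^ i * (-1) ^ l := by
          rw [show j + l + (j + i) = 2 * j + (i + l) by omega, pow_add, pow_mul, pow_add]; simp
        rw [hs, neg_pow y]
        have := fne j; have := fne l; have := fne i; have := fne (d + j)
        have := fne (j + l); have := fne (j + i + d)
        field_simp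
        ring
      · intro a _ ha
        rw [Nat.choose_eq_zero_of_lt (n := a)]
        · simp
        · simp only [Finset.mem_Ico, Finset.mem_range] at *; omega
    · intro b _ hb
      apply Finset.sum_eq_zero
      intro a _
      rw [Nat.choose_eq_zero_of_lt (n := b + d)]
      · simp
      · simp only [Finset.mem_Ico, Finset.mem_range] at *; omega
  rw [Finset.sum_congr rfl e1, Finset.sum_comm, mul_comm, laguerreSum_eq_sum_range (M := M) (x := y)
    (by omega), Finset.sum_mul]
  refine Finset.sum_congr rfl fun b hb => ?_
  rw [Finset.sum_comm, laguerreSum_eq_sum_range (M := M) (x := x) (by omega),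
    Finset.mul_sum, Finset.mul_sum]
  refine Finset.sum_congr rfl fun a ha => ?_
  rw [← Finset.mul_sum, ← Nat.cast_sum]
  have e2 : ∑ j ∈ Finset.range M,
      a.choose j * (b + d).choose (d + j) * (K + d + j).choose (a + b + d) =
      (K + d).choose (a + d) * K.choose b := by
    rw [← sum_choose_mul_choose_mul_choose]
    have hsub : Finset.range (b + 1) ⊆ Finset.range M := by
      intro j; simp only [Finset.mem_range] at *; omega
    rw [← Finset.sum_subset hsub]
    · refine Finset.sum_congr rfl fun j hj => ?_
      rw [Finset.mem_range] at hj
      rw [← Nat.choose_symm (n := b + d) (k := b - j) (by omega),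
        show b + d - (b - j) = d + j by omega]
    · intro j _ hj
      rw [Finset.mem_range] at hj
      rw [Nat.choose_eq_zero_of_lt (n := b + d) (by omega)]; simp
  rw [e2]
  have e3 := choose_mul_factorial_div (K := K) (d := d) (b := b)
  push_cast
  rw [add_comm d a, pow_add]
  have hb0 := fne b
  calc _ = (-1) ^ a * (-1) ^ b * x ^ a * y ^ b / a.factorial * (K + d).choose (a + d) *
        (K.choose b / (b + d).factorial) := by
        have := fne a; have := fne (b + d); field_simp
    _ = _ := by rw [← e3]; ring

theorem choose_add_add_eq_sum_range {N b l S : ℕ} (h : N < l + S) :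
    (N + b).choose (l + b) = ∑ s ∈ Finset.range S, b.choose s * N.choose (l + s) := by
  have h1 : (N + b).choose (l + b) =
      ∑ s ∈ Finset.range (b + 1), b.choose s * N.choose (l + s) := by
    rw [add_comm N b, choose_add_eq_sum_range, ← Finset.sum_range_reflect (n := b + 1)]
    symm
    have hsub : Finset.range (b + 1) ⊆ Finset.range (l + b + 1) := by
      intro j; simp only [Finset.mem_range] at *; omega
    rw [← Finset.sum_subset hsub]
    · refine Finset.sum_congr rfl fun t ht => ?_
      rw [Finset.mem_range] at ht
      rw [show b + 1 - 1 - t = b - t by omega, Nat.choose_symm (by omega),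
        show l + (b - t) = l + b - t by omega]
    · intro t _ ht
      rw [Finset.mem_range] at ht
      rw [Nat.choose_eq_zero_of_lt (by omega), zero_mul]
  -- Terms with `s > b` vanish through `b.choose s` and terms with `s ≥ S` through `N.choose (l +
  -- s)`, so either cut-off may be enlarged to a common one.
  have key : ∀ T, b + 1 ≤ T → N < l + T → ∀ R, (b + 1 = R ∨ S = R) → R ≤ T →
      ∑ s ∈ Finset.range R, b.choose s * N.choose (l + s) =
      ∑ s ∈ Finset.range T, b.choose s * N.choose (l + s) := by
    intro T _ _ R hR hRT
    apply Finset.sum_subset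
    · intro t; simp only [Finset.mem_range]; omega
    · intro t _ ht
      rw [Finset.mem_range] at ht
      rcases hR with rfl | rfl
      · rw [Nat.choose_eq_zero_of_lt (by omega), zero_mul]
      · rw [Nat.choose_eq_zero_of_lt (n := N) (by omega), mul_zero]
  rw [h1, key (b + 1 + S) (by omega) (by omega) (b + 1) (Or.inl rfl) (by omega),
    key (b + 1 + S) (by omega) (by omega) S (Or.inr rfl) (by omega)]

/-- This is the relation `L_k^{d+1} = L_k^d + L_{k-1}^{d+1}` iterated `b` times. It later resums the
terms created by the exponential factor. -/
theorem laguerreSum_add_add_eq_sum {N D b S : ℕ} (h : N < D + S) (x : ℂ) :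
    laguerreSum (N + b) (D + b) x =
      ∑ s ∈ Finset.range S, (b.choose s : ℂ) * laguerreSum N (D + s) x := by
  rw [laguerreSum_eq_sum_range (M := S) (by omega)]
  have : ∀ s ∈ Finset.range S, (b.choose s : ℂ) * laguerreSum N (D + s) x =
      ∑ i ∈ Finset.range S,
        b.choose s * ((-1) ^ i * (N.choose (D + s + i) : ℂ) * x ^ i / (i.factorial : ℂ)) := by
    intro s _
    rw [laguerreSum_eq_sum_range (M := S) (by omega), Finset.mul_sum]
  rw [Finset.sum_congr rfl this, Finset.sum_comm]
  refine Finset.sum_congr rfl fun i _ => ?_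
  rw [show D + b + i = D + i + b by omega,
    choose_add_add_eq_sum_range (l := D + i) (S := S) (by omega)]
  push_cast
  rw [Finset.mul_sum, Finset.sum_mul, Finset.sum_div]
  refine Finset.sum_congr rfl fun s _ => ?_
  rw [add_right_comm D s i]
  ring

/-! ### Termwise integration of the exponential on a compact space -/

section

variable {α : Type*} [TopologicalSpace α] [CompactSpace α] [MeasurableSpace α]
  [OpensMeasurableSpace α] {μ : Measure α} [IsFiniteMeasure μ]

theorem Continuous.integrable_of_finite_of_compact {f : α → ℂ} (hf : Continuous f) :
    Integrable f μ :=
  hf.integrable_of_hasCompactSupport (HasCompactSupport.of_compactSpace f)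

theorem hasSum_integral_mul_exp {f B : α → ℂ} (hf : Continuous f) (hB : Continuous B) :
    HasSum (fun b : ℕ => (∫ x, f x * B x ^ b ∂μ) / (b.factorial : ℂ))
      (∫ x, f x * Complex.exp (B x) ∂μ) := by
  obtain ⟨C, hC⟩ := isCompact_univ.exists_bound_of_continuousOn hf.continuousOn
  obtain ⟨R, hR⟩ := isCompact_univ.exists_bound_of_continuousOn hB.continuousOn
  have hint : ∀ b : ℕ, Integrable (fun x => f x * B x ^ b / (b.factorial : ℂ)) μ := fun b =>
    Continuous.integrable_of_finite_of_compact (by fun_prop)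
  have hbd : ∀ (b : ℕ) x, ‖f x * B x ^ b / (b.factorial : ℂ)‖ ≤ C * (|R| ^ b / b.factorial) := by
    intro b x
    rw [norm_div, norm_mul, norm_pow, Complex.norm_natCast, mul_div_assoc]
    have h1 := hC x trivial
    have h2 := hR x trivial
    have h3 : ‖B x‖ ≤ |R| := h2.trans (le_abs_self R)
    have : 0 ≤ C := (norm_nonneg _).trans h1
    gcongr
  have := hasSum_integral_of_summable_integral_norm hint (by
    refine Summable.of_nonneg_of_le (fun b => integral_nonneg fun x => norm_nonneg _)
      (fun b => ?_) (((Real.summable_pow_div_factorial |R|).mul_left C).mul_left (μ.real Set.univ))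
    calc _ ≤ ∫ _, C * (|R| ^ b / b.factorial) ∂μ :=
          integral_mono (hint b).norm (integrable_const _) (hbd b)
      _ = _ := by rw [integral_const, smul_eq_mul])
  have e : ∫ x, f x * Complex.exp (B x) ∂μ =
      ∫ x, ∑' b : ℕ, f x * B x ^ b / (b.factorial : ℂ) ∂μ := by
    refine integral_congr_ae (Filter.Eventually.of_forall fun x => ?_)
    have := (Complex.exp_eq_exp_ℂ ▸ NormedSpace.expSeries_div_hasSum_exp (B x)).mul_left (f x)
    simp only
    rw [← this.tsum_eq]
    exact tsum_congr fun b => by rw [mul_div_assoc]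
  rw [e]
  simpa only [integral_div] using this

/-- If the only nonvanishing moments `∫ h A^a B^b` are those with `a = q + j`, `b = p + j`,
the integral of `h e^B L(X - A - B)` is a finite sum of Laguerre polynomials. -/
theorem integral_mul_exp_mul_laguerreSum {N D M p q : ℕ} (hM : N < D + M) {h A B : α → ℂ}
    (hh : Continuous h) (hA : Continuous A) (hB : Continuous B) (X : ℂ) (c : ℕ → ℂ)
    (hz : ∀ a b, (¬ ∃ j, a = q + j ∧ b = p + j) → ∫ x, h x * A x ^ a * B x ^ b ∂μ = 0)
    (hc : ∀ j, ∫ x, h x * A x ^ (q + j) * B x ^ (p + j) ∂μ =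
      (q + j).factorial * (p + j).factorial * c j) :
    ∫ x, h x * Complex.exp (B x) * laguerreSum N D (X - A x - B x) ∂μ =
      ∑ j ∈ Finset.range M, c j * laguerreSum (N + p + j) (D + p + q + 2 * j) X := by
  have fne : ∀ l : ℕ, (l.factorial : ℂ) ≠ 0 := fun l => Nat.cast_ne_zero.mpr l.factorial_ne_zero
  have hI : ∀ a s : ℕ, HasSum
      (fun b : ℕ => (∫ x, h x * A x ^ a * B x ^ (s + b) ∂μ) / (b.factorial : ℂ))
      (∫ x, h x * A x ^ a * B x ^ s * Complex.exp (B x) ∂μ) := by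
    intro a s
    have := hasSum_integral_mul_exp (μ := μ) (f := fun x => h x * A x ^ a * B x ^ s) (B := B)
      (by fun_prop) hB
    simpa only [pow_add, mul_assoc] using this
  have hI0 : ∀ a s : ℕ, a < q → ∫ x, h x * A x ^ a * B x ^ s * Complex.exp (B x) ∂μ = 0 := by
    intro a s ha
    refine (hI a s).unique ?_
    convert hasSum_zero with b
    rw [hz _ _ (by rintro ⟨j, hj, -⟩; omega), zero_div]
  -- Of the exponential series only the term of order `p + j - s` has a nonzero moment, which yields
  -- the binomial coefficient needed for `laguerreSum_add_add_eq_sum`.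
  have hI1 : ∀ j s : ℕ, ∫ x, h x * A x ^ (q + j) * B x ^ s * Complex.exp (B x) ∂μ =
      (q + j).factorial * s.factorial * (p + j).choose s * c j := by
    intro j s
    refine (hI (q + j) s).unique ?_
    have hne : ∀ b : ℕ, s + b ≠ p + j →
        (∫ x, h x * A x ^ (q + j) * B x ^ (s + b) ∂μ) / (b.factorial : ℂ) = 0 := by
      intro b hb
      rw [hz _ _ (by rintro ⟨i, hi, hi'⟩; omega), zero_div]
    rcases le_or_gt s (p + j) with hs | hs
    · convert hasSum_single (p + j - s) (fun b hb => hne b (by omega)) using 1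
      rw [Nat.add_sub_cancel' hs, hc, Nat.cast_choose ℂ hs]
      have := fne s
      have := fne (p + j - s)
      field_simp
    · rw [Nat.choose_eq_zero_of_lt hs]
      convert hasSum_zero with b
      · exact hne b (by omega)
      · simp
  have hexp : ∀ x, h x * Complex.exp (B x) * laguerreSum N D (X - A x - B x) =
      ∑ a ∈ Finset.range (q + M), ∑ s ∈ Finset.range M,
        (laguerreSum N (D + a + s) X / (a.factorial * s.factorial)) *
          (h x * A x ^ a * B x ^ s * Complex.exp (B x)) := by
    intro x
    rw [sub_right_comm, sub_eq_add_neg, laguerreSum_add (M := q + M) (by omega), Finset.mul_sum]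
    refine Finset.sum_congr rfl fun a _ => ?_
    rw [sub_eq_add_neg, laguerreSum_add (M := M) (by omega), Finset.mul_sum, Finset.mul_sum]
    refine Finset.sum_congr rfl fun s _ => ?_
    have := fne a
    have := fne s
    simp only [neg_neg]
    field_simp
  simp_rw [hexp]
  have hint : ∀ a s, Integrable (fun x =>
      (laguerreSum N (D + a + s) X / (a.factorial * s.factorial)) *
          (h x * A x ^ a * B x ^ s * Complex.exp (B x))) μ := fun a s =>
    Continuous.integrable_of_finite_of_compact
      (continuous_const.mul (by fun_prop))
  rw [integral_finsetSum _ fun a _ => integrable_finsetSum _ fun s _ => hint a s]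
  simp_rw [integral_finsetSum _ fun s _ => hint _ s, integral_const_mul]
  rw [Finset.sum_range_add]
  rw [Finset.sum_eq_zero (s := Finset.range q), zero_add]
  · refine Finset.sum_congr rfl fun j _ => ?_
    rw [show N + p + j = N + (p + j) by omega,
      show D + p + q + 2 * j = D + (q + j) + (p + j) by omega,
      laguerreSum_add_add_eq_sum (S := M) (by omega), Finset.mul_sum]
    refine Finset.sum_congr rfl fun s _ => ?_
    rw [hI1]
    have := fne s
    have := fne (q + j)
    field_simp
  · intro a ha
    apply Finset.sum_eq_zero
    intro s _
    rw [hI0 a s (Finset.mem_range.mp ha), mul_zero]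

end

/-! ### Polynomials in `z`, `z̄` and integration by parts against the Gaussian -/

section

variable {n : ℕ}

/-- The real-linear coordinate functions `z_j` (left summand) and `z̄_j` (right summand). -/
noncomputable def coordCLM : Fin n ⊕ Fin n → (EuclideanSpace ℂ (Fin n) →L[ℝ] ℂ) :=
  Sum.elim
    (fun j => (EuclideanSpace.proj j : EuclideanSpace ℂ (Fin n) →L[ℂ] ℂ).restrictScalars ℝ)
    (fun j => (Complex.conjCLE : ℂ →L[ℝ] ℂ).comp
      ((EuclideanSpace.proj j : EuclideanSpace ℂ (Fin n) →L[ℂ] ℂ).restrictScalars ℝ))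

@[simp] theorem coordCLM_inl (j : Fin n) (z : EuclideanSpace ℂ (Fin n)) :
    coordCLM (Sum.inl j) z = z j := rfl

@[simp] theorem coordCLM_inr (j : Fin n) (z : EuclideanSpace ℂ (Fin n)) :
    coordCLM (Sum.inr j) z = (starRingEnd ℂ) (z j) := rfl

/-- The function `P(z, z̄)` on `ℂⁿ` given by a polynomial `P` in `z` and `z̄`. -/
noncomputable def polyFun (f : MvPolynomial (Fin n ⊕ Fin n) ℂ) (z : EuclideanSpace ℂ (Fin n)) : ℂ :=
  MvPolynomial.eval (fun i => coordCLM i z) f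

@[simp] theorem polyFun_C (c : ℂ) (z : EuclideanSpace ℂ (Fin n)) :
    polyFun (MvPolynomial.C c) z = c := by simp [polyFun]

@[simp] theorem polyFun_one (z : EuclideanSpace ℂ (Fin n)) : polyFun 1 z = 1 := by simp [polyFun]

@[simp] theorem polyFun_X (i : Fin n ⊕ Fin n) (z : EuclideanSpace ℂ (Fin n)) :
    polyFun (MvPolynomial.X i) z = coordCLM i z := by simp [polyFun]

@[simp] theorem polyFun_add (f g : MvPolynomial (Fin n ⊕ Fin n) ℂ)
    (z : EuclideanSpace ℂ (Fin n)) : polyFun (f + g) z = polyFun f z + polyFun g z := by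
  simp [polyFun]

@[simp] theorem polyFun_mul (f g : MvPolynomial (Fin n ⊕ Fin n) ℂ)
    (z : EuclideanSpace ℂ (Fin n)) : polyFun (f * g) z = polyFun f z * polyFun g z := by
  simp [polyFun]

@[simp] theorem polyFun_pow (f : MvPolynomial (Fin n ⊕ Fin n) ℂ) (k : ℕ)
    (z : EuclideanSpace ℂ (Fin n)) : polyFun (f ^ k) z = polyFun f z ^ k := by
  simp [polyFun]

@[simp] theorem polyFun_smul (c : ℂ) (f : MvPolynomial (Fin n ⊕ Fin n) ℂ)
    (z : EuclideanSpace ℂ (Fin n)) : polyFun (c • f) z = c * polyFun f z := by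
  simp [polyFun, MvPolynomial.smul_eval]

@[simp] theorem polyFun_sum {ι : Type*} (s : Finset ι) (f : ι → MvPolynomial (Fin n ⊕ Fin n) ℂ)
    (z : EuclideanSpace ℂ (Fin n)) : polyFun (∑ i ∈ s, f i) z = ∑ i ∈ s, polyFun (f i) z := by
  simp [polyFun]

theorem polyFun_prod {ι : Type*} (s : Finset ι) (f : ι → MvPolynomial (Fin n ⊕ Fin n) ℂ)
    (z : EuclideanSpace ℂ (Fin n)) : polyFun (∏ i ∈ s, f i) z = ∏ i ∈ s, polyFun (f i) z := by
  simp [polyFun]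

theorem hasFDerivAt_polyFun (f : MvPolynomial (Fin n ⊕ Fin n) ℂ) (z : EuclideanSpace ℂ (Fin n)) :
    HasFDerivAt (polyFun f) (∑ i, polyFun (MvPolynomial.pderiv i f) z • coordCLM i) z := by
  induction f using MvPolynomial.induction_on with
  | C a =>
    have : polyFun (n := n) (MvPolynomial.C a) = fun _ => a := by funext z; simp
    rw [this]
    refine (hasFDerivAt_const a z).congr_fderiv ?_
    ext v
    simp [polyFun]
  | add f g hf hg =>
    have : polyFun (f + g) = polyFun f + polyFun g := by funext z; simp
    rw [this]
    refine (hf.add hg).congr_fderiv ?_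
    ext v
    simp only [map_add, polyFun_add, add_mul, Finset.sum_add_distrib, add_apply, smul_apply,
      sum_apply, smul_eq_mul]
  | mul_X f j hf =>
    have : polyFun (f * MvPolynomial.X j) = fun z => polyFun f z * coordCLM j z := by
      funext z; simp
    rw [this]
    refine (hf.mul (coordCLM j).hasFDerivAt).congr_fderiv ?_
    ext v
    simp only [Derivation.leibniz, polyFun_add, smul_eq_mul, polyFun_mul, polyFun_X, add_mul,
      Finset.sum_add_distrib, add_apply, smul_apply, sum_apply, Finset.mul_sum, mul_assoc]
    congr 1
    rw [Finset.sum_eq_single j]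
    · simp
    · intro b _ hb
      simp [MvPolynomial.pderiv_X, hb.symm, polyFun]
    · simp

theorem continuous_polyFun (f : MvPolynomial (Fin n ⊕ Fin n) ℂ) : Continuous (polyFun f) :=
  continuous_iff_continuousAt.mpr fun z => (hasFDerivAt_polyFun f z).continuousAt

theorem fderiv_polyFun (f : MvPolynomial (Fin n ⊕ Fin n) ℂ) (z v : EuclideanSpace ℂ (Fin n)) :
    fderiv ℝ (polyFun f) z v = ∑ i, polyFun (MvPolynomial.pderiv i f) z * coordCLM i v := by
  rw [(hasFDerivAt_polyFun f z).fderiv]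
  simp

theorem norm_coordCLM_apply_le (i : Fin n ⊕ Fin n) (z : EuclideanSpace ℂ (Fin n)) :
    ‖coordCLM i z‖ ≤ ‖z‖ := by
  rcases i with j | j
  · simpa using PiLp.norm_apply_le z j
  · simpa using PiLp.norm_apply_le z j

theorem exists_norm_polyFun_le (f : MvPolynomial (Fin n ⊕ Fin n) ℂ) :
    ∃ (C : ℝ) (k : ℕ), 0 ≤ C ∧ ∀ z, ‖polyFun f z‖ ≤ C * (1 + ‖z‖) ^ k := by
  induction f using MvPolynomial.induction_on with
  | C a => exact ⟨‖a‖, 0, norm_nonneg _, by simp⟩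
  | add f g hf hg =>
    obtain ⟨C, k, hC, h⟩ := hf
    obtain ⟨C', k', hC', h'⟩ := hg
    refine ⟨C + C', k + k', by positivity, fun z => ?_⟩
    have h1 : (1 : ℝ) ≤ 1 + ‖z‖ := by linarith [norm_nonneg z]
    rw [polyFun_add, add_mul]
    refine (norm_add_le _ _).trans (add_le_add ((h z).trans ?_) ((h' z).trans ?_))
    · gcongr
      omega
    · gcongr
      omega
  | mul_X f j hf =>
    obtain ⟨C, k, hC, h⟩ := hf
    refine ⟨C, k + 1, hC, fun z => ?_⟩
    rw [polyFun_mul, norm_mul, pow_succ, ← mul_assoc, polyFun_X]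
    have := norm_coordCLM_apply_le j z
    gcongr
    · exact h z
    · linarith

theorem integrable_rexp_neg_mul_sq_norm {b : ℝ} (hb : 0 < b) :
    Integrable (fun z : EuclideanSpace ℂ (Fin n) => Real.exp (-b * ‖z‖ ^ 2)) := by
  have := (GaussianFourier.integrable_cexp_neg_mul_sq_norm_add (b := (b : ℂ)) (by simpa using hb) 0
    (0 : EuclideanSpace ℂ (Fin n))).norm
  refine this.congr (Filter.Eventually.of_forall fun z => ?_)
  simp only [zero_mul, add_zero, Complex.norm_exp]
  congr 1
  norm_cast

theorem integrable_polyFun_mul_exp (f : MvPolynomial (Fin n ⊕ Fin n) ℂ) :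
    Integrable (fun z : EuclideanSpace ℂ (Fin n) =>
      polyFun f z * (Real.exp (-‖z‖ ^ 2) : ℂ)) := by
  obtain ⟨C, k, hC, h⟩ := exists_norm_polyFun_le f
  refine ((integrable_rexp_neg_mul_sq_norm (n := n) (b := 1 / 2) (by norm_num)).const_mul
    (C * (k.factorial * Real.exp (3 / 2)))).mono' ?_ (Filter.Eventually.of_forall fun z => ?_)
  · have := continuous_polyFun f
    have : Continuous fun z : EuclideanSpace ℂ (Fin n) =>
      polyFun f z * (Real.exp (-‖z‖ ^ 2) : ℂ) := by fun_prop
    exact this.aestronglyMeasurable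
  · rw [norm_mul, Complex.norm_real, Real.norm_eq_abs, Real.abs_exp]
    have h1 : (1 + ‖z‖) ^ k ≤ k.factorial * Real.exp (1 + ‖z‖) := by
      have := Real.pow_div_factorial_le_exp (1 + ‖z‖) (by positivity) k
      rwa [div_le_iff₀' (by positivity)] at this
    calc _ ≤ C * (k.factorial * Real.exp (1 + ‖z‖)) * Real.exp (-‖z‖ ^ 2) := by
          gcongr
          exact (h z).trans (by gcongr)
      _ = C * (k.factorial * Real.exp (1 + ‖z‖ - ‖z‖ ^ 2)) := by
          rw [sub_eq_add_neg, Real.exp_add (1 + ‖z‖)]; ring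
      _ ≤ C * (k.factorial * Real.exp (3 / 2 + -(1 / 2) * ‖z‖ ^ 2)) := by
          gcongr
          -- The exponents differ by `(‖z‖ - 1)² / 2`.
          nlinarith [sq_nonneg (‖z‖ - 1)]
      _ = _ := by rw [Real.exp_add]; ring

/-- The Gaussian integral `∫ f(z, z̄) e^{-|z|²} dz` of a polynomial. -/
noncomputable def gaussInt : MvPolynomial (Fin n ⊕ Fin n) ℂ →ₗ[ℂ] ℂ where
  toFun f := ∫ z : EuclideanSpace ℂ (Fin n), polyFun f z * (Real.exp (-‖z‖ ^ 2) : ℂ)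
  map_add' f g := by
    simp_rw [polyFun_add, add_mul]
    exact integral_add (integrable_polyFun_mul_exp f) (integrable_polyFun_mul_exp g)
  map_smul' c f := by
    simp_rw [polyFun_smul, mul_assoc, RingHom.id_apply, smul_eq_mul]
    exact integral_const_mul _ _

theorem gaussInt_apply (f : MvPolynomial (Fin n ⊕ Fin n) ℂ) :
    gaussInt f = ∫ z : EuclideanSpace ℂ (Fin n), polyFun f z * (Real.exp (-‖z‖ ^ 2) : ℂ) := rfl

theorem finrank_euclideanSpace_complex :
    Module.finrank ℝ (EuclideanSpace ℂ (Fin n)) = 2 * n := by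
  rw [← Module.finrank_mul_finrank ℝ ℂ, Complex.finrank_real_complex, finrank_euclideanSpace_fin]

theorem gaussInt_one : gaussInt (1 : MvPolynomial (Fin n ⊕ Fin n) ℂ) = (Real.pi : ℂ) ^ n := by
  have := GaussianFourier.integral_rexp_neg_mul_sq_norm (V := EuclideanSpace ℂ (Fin n)) one_pos
  rw [gaussInt_apply]
  simp only [polyFun_one, one_mul]
  rw [integral_complex_ofReal]
  simp only [neg_mul, one_mul] at this
  rw [this, finrank_euclideanSpace_complex, div_one]
  push_cast
  rw [mul_div_cancel_left₀ _ two_ne_zero, Real.rpow_natCast]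
  push_cast
  rfl

/-- Integration by parts against the Gaussian. -/
theorem gaussInt_sum_pderiv (f : MvPolynomial (Fin n ⊕ Fin n) ℂ) (v : EuclideanSpace ℂ (Fin n)) :
    gaussInt (∑ i, coordCLM i v • MvPolynomial.pderiv i f) =
      gaussInt (f * ∑ j, ((starRingEnd ℂ) (v j) • MvPolynomial.X (Sum.inl j) +
        v j • MvPolynomial.X (Sum.inr j))) := by
  have hg : ∀ z : EuclideanSpace ℂ (Fin n), HasFDerivAt
      (fun z : EuclideanSpace ℂ (Fin n) => (Real.exp (-‖z‖ ^ 2) : ℂ))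
      (Complex.ofRealCLM.comp (Real.exp (-‖z‖ ^ 2) • (-(2 • innerSL ℝ z)))) z := by
    intro z
    exact Complex.ofRealCLM.hasFDerivAt.comp z
      (((hasStrictFDerivAt_norm_sq z).hasFDerivAt.neg).exp)
  have hg' : ∀ z v : EuclideanSpace ℂ (Fin n), fderiv ℝ
      (fun z : EuclideanSpace ℂ (Fin n) => (Real.exp (-‖z‖ ^ 2) : ℂ)) z v =
        -((2 * inner ℝ z v : ℝ) * (Real.exp (-‖z‖ ^ 2) : ℂ)) := by
    intro z v
    rw [(hg z).fderiv]
    simp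
    ring
  have hf' : ∀ z, fderiv ℝ (polyFun f) z v =
      polyFun (∑ i, coordCLM i v • MvPolynomial.pderiv i f) z := by
    intro z
    rw [fderiv_polyFun, polyFun_sum]
    exact Finset.sum_congr rfl fun i _ => by rw [polyFun_smul, mul_comm]
  have hin : ∀ z : EuclideanSpace ℂ (Fin n), ((2 * inner ℝ z v : ℝ) : ℂ) =
      polyFun (∑ j, ((starRingEnd ℂ) (v j) • MvPolynomial.X (Sum.inl j) +
        v j • MvPolynomial.X (Sum.inr j))) z := by
    intro z
    rw [polyFun_sum, PiLp.inner_apply, Finset.mul_sum, Complex.ofReal_sum]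
    refine Finset.sum_congr rfl fun j _ => ?_
    simp only [polyFun_add, polyFun_smul, polyFun_X, coordCLM_inl, coordCLM_inr, Complex.inner]
    apply Complex.ext <;> simp <;> ring
  have := integral_mul_fderiv_eq_neg_fderiv_mul_of_integrable (μ := volume) (𝕜 := ℂ)
    (f := polyFun f) (v := v)
    (g := fun z : EuclideanSpace ℂ (Fin n) => (Real.exp (-‖z‖ ^ 2) : ℂ))
    (by simp_rw [hf']; exact integrable_polyFun_mul_exp _)
    (by
      simp_rw [hg', hin, mul_neg, ← mul_assoc, ← polyFun_mul]
      exact (integrable_polyFun_mul_exp _).neg)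
    (integrable_polyFun_mul_exp f)
    (fun z _ => (hasFDerivAt_polyFun f z).differentiableAt)
    (fun z _ => (hg z).differentiableAt)
  simp_rw [hg', hf', mul_neg, integral_neg, neg_inj, hin, ← mul_assoc, ← polyFun_mul] at this
  rw [gaussInt_apply, ← this, gaussInt_apply]

/-- Integration by parts is available in real directions only. The directions `c = 1` and `c = i` in
the `j`-th coordinate together separate `∂_j` from `∂̄_j`. -/
theorem gaussInt_pderiv_add_pderiv (f : MvPolynomial (Fin n ⊕ Fin n) ℂ) (j : Fin n) (c : ℂ) :
    c * gaussInt (MvPolynomial.pderiv (Sum.inl j) f) +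
      (starRingEnd ℂ) c * gaussInt (MvPolynomial.pderiv (Sum.inr j) f) =
    c * gaussInt (MvPolynomial.X (Sum.inr j) * f) +
      (starRingEnd ℂ) c * gaussInt (MvPolynomial.X (Sum.inl j) * f) := by
  have h := gaussInt_sum_pderiv f (EuclideanSpace.single j c)
  have h1 : ∑ i, coordCLM i (EuclideanSpace.single j c) • MvPolynomial.pderiv i f =
      c • MvPolynomial.pderiv (Sum.inl j) f +
        (starRingEnd ℂ) c • MvPolynomial.pderiv (Sum.inr j) f := by
    rw [Fintype.sum_sum_type]
    congr 1
    · rw [Finset.sum_eq_single j]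
      · simp
      · intro b _ hb; simp [hb]
      · simp
    · rw [Finset.sum_eq_single j]
      · simp
      · intro b _ hb; simp [hb]
      · simp
  have h2 : f * ∑ i, ((starRingEnd ℂ) (EuclideanSpace.single j c i) • MvPolynomial.X (Sum.inl i) +
      EuclideanSpace.single j c i • MvPolynomial.X (Sum.inr i)) =
      c • (MvPolynomial.X (Sum.inr j) * f) +
        (starRingEnd ℂ) c • (MvPolynomial.X (Sum.inl j) * f) := by
    rw [Finset.sum_eq_single j]
    · simp only [PiLp.single_apply, if_true, mul_add, mul_smul_comm]
      rw [add_comm, mul_comm f, mul_comm f]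
    · intro b _ hb; simp [hb]
    · simp
  rw [h1, h2, map_add, map_smul, map_smul, map_add, map_smul, map_smul] at h
  simpa only [smul_eq_mul] using h

theorem gaussInt_pderiv_inl (f : MvPolynomial (Fin n ⊕ Fin n) ℂ) (j : Fin n) :
    gaussInt (MvPolynomial.pderiv (Sum.inl j) f) = gaussInt (MvPolynomial.X (Sum.inr j) * f) := by
  have h1 := gaussInt_pderiv_add_pderiv f j 1
  have h2 := gaussInt_pderiv_add_pderiv f j Complex.I
  simp only [map_one, one_mul, Complex.conj_I] at h1 h2
  linear_combination (1 / 2 : ℂ) * h1 - (Complex.I / 2) * h2 +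
    (1 / 2 : ℂ) * (gaussInt (MvPolynomial.pderiv (Sum.inl j) f) -
      gaussInt (MvPolynomial.pderiv (Sum.inr j) f) -
      gaussInt (MvPolynomial.X (Sum.inr j) * f) +
      gaussInt (MvPolynomial.X (Sum.inl j) * f)) * Complex.I_sq

theorem gaussInt_pderiv_inr (f : MvPolynomial (Fin n ⊕ Fin n) ℂ) (j : Fin n) :
    gaussInt (MvPolynomial.pderiv (Sum.inr j) f) = gaussInt (MvPolynomial.X (Sum.inl j) * f) := by
  have h1 := gaussInt_pderiv_add_pderiv f j 1
  have h2 := gaussInt_pderiv_inl f j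
  simp only [map_one, one_mul] at h1
  linear_combination h1 - h2

end

/-! ### Gaussian moments of bigraded harmonic polynomials -/

section

variable {n : ℕ}

/-- The commutator of two derivations is a derivation, and this one kills every variable. -/
theorem pderiv_pderiv_comm {σ : Type*} (i j : σ) (f : MvPolynomial σ ℂ) :
    MvPolynomial.pderiv i (MvPolynomial.pderiv j f) =
      MvPolynomial.pderiv j (MvPolynomial.pderiv i f) := by
  classical
  have : ⁅MvPolynomial.pderiv (R := ℂ) i, MvPolynomial.pderiv (R := ℂ) j⁆ = 0 := by
    refine MvPolynomial.derivation_ext fun k => ?_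
    rw [Derivation.commutator_apply, MvPolynomial.pderiv_X, MvPolynomial.pderiv_X]
    simp only [Pi.single_apply]
    split_ifs <;> simp
  have h := congrArg (fun D : Derivation ℂ (MvPolynomial σ ℂ) (MvPolynomial σ ℂ) => D f) this
  simp only [Derivation.commutator_apply, Derivation.coe_zero, Pi.zero_apply, sub_eq_zero] at h
  exact h

/-- The holomorphic derivative `z · ∂` in the direction `z`. -/
noncomputable def holDeriv (z : EuclideanSpace ℂ (Fin n)) :
    Derivation ℂ (MvPolynomial (Fin n ⊕ Fin n) ℂ) (MvPolynomial (Fin n ⊕ Fin n) ℂ) :=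
  ∑ j, z j • MvPolynomial.pderiv (Sum.inl j)

/-- The antiholomorphic derivative `z̄ · ∂̄` in the direction `z`. -/
noncomputable def antiholDeriv (z : EuclideanSpace ℂ (Fin n)) :
    Derivation ℂ (MvPolynomial (Fin n ⊕ Fin n) ℂ) (MvPolynomial (Fin n ⊕ Fin n) ℂ) :=
  ∑ j, (starRingEnd ℂ) (z j) • MvPolynomial.pderiv (Sum.inr j)

/-- The linear polynomial `w ↦ w · z̄`. -/
noncomputable def holLin (z : EuclideanSpace ℂ (Fin n)) : MvPolynomial (Fin n ⊕ Fin n) ℂ :=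
  ∑ j, (starRingEnd ℂ) (z j) • MvPolynomial.X (Sum.inl j)

/-- The linear polynomial `w ↦ w̄ · z`. -/
noncomputable def antiholLin (z : EuclideanSpace ℂ (Fin n)) : MvPolynomial (Fin n ⊕ Fin n) ℂ :=
  ∑ j, z j • MvPolynomial.X (Sum.inr j)

/-- The operator `∑ ∂̄_j ∂_j`, a quarter of the Laplacian. -/
noncomputable def boxOp (f : MvPolynomial (Fin n ⊕ Fin n) ℂ) : MvPolynomial (Fin n ⊕ Fin n) ℂ :=
  ∑ j, MvPolynomial.pderiv (Sum.inr j) (MvPolynomial.pderiv (Sum.inl j) f)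

theorem holDeriv_apply (z : EuclideanSpace ℂ (Fin n)) (f : MvPolynomial (Fin n ⊕ Fin n) ℂ) :
    holDeriv z f = ∑ j, z j • MvPolynomial.pderiv (Sum.inl j) f := by
  change Derivation.coeFnAddMonoidHom (∑ j, _) f = _
  rw [map_sum, Finset.sum_apply]
  rfl

theorem antiholDeriv_apply (z : EuclideanSpace ℂ (Fin n)) (f : MvPolynomial (Fin n ⊕ Fin n) ℂ) :
    antiholDeriv z f = ∑ j, (starRingEnd ℂ) (z j) • MvPolynomial.pderiv (Sum.inr j) f := by
  change Derivation.coeFnAddMonoidHom (∑ j, _) f = _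
  rw [map_sum, Finset.sum_apply]
  rfl

theorem gaussInt_holDeriv (z : EuclideanSpace ℂ (Fin n)) (f : MvPolynomial (Fin n ⊕ Fin n) ℂ) :
    gaussInt (holDeriv z f) = gaussInt (antiholLin z * f) := by
  simp_rw [holDeriv_apply, antiholLin, Finset.sum_mul, map_sum, smul_mul_assoc, map_smul,
    gaussInt_pderiv_inl]

theorem gaussInt_antiholDeriv (z : EuclideanSpace ℂ (Fin n))
    (f : MvPolynomial (Fin n ⊕ Fin n) ℂ) :
    gaussInt (antiholDeriv z f) = gaussInt (holLin z * f) := by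
  simp_rw [antiholDeriv_apply, holLin, Finset.sum_mul, map_sum, smul_mul_assoc, map_smul,
    gaussInt_pderiv_inr]

theorem holDeriv_antiholLin (z : EuclideanSpace ℂ (Fin n)) : holDeriv z (antiholLin z) = 0 := by
  rw [holDeriv_apply]
  simp [antiholLin, MvPolynomial.pderiv_X]

theorem antiholDeriv_holLin (z : EuclideanSpace ℂ (Fin n)) : antiholDeriv z (holLin z) = 0 := by
  rw [antiholDeriv_apply]
  simp [holLin, MvPolynomial.pderiv_X]

theorem antiholDeriv_antiholLin (z : EuclideanSpace ℂ (Fin n)) :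
    antiholDeriv z (antiholLin z) = MvPolynomial.C ((‖z‖ ^ 2 : ℝ) : ℂ) := by
  rw [antiholDeriv_apply]
  have : ∀ j, MvPolynomial.pderiv (Sum.inr j) (antiholLin z) = MvPolynomial.C (z j) := by
    intro j
    simp only [antiholLin, map_sum, Derivation.map_smul]
    rw [Finset.sum_eq_single j]
    · simp [MvPolynomial.smul_eq_C_mul]
    · intro b _ hb
      rw [MvPolynomial.pderiv_X_of_ne (by simpa using hb), smul_zero]
    · simp
  simp_rw [this, MvPolynomial.smul_eq_C_mul, ← map_mul, ← map_sum]
  congr 1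
  rw [EuclideanSpace.norm_sq_eq]
  push_cast
  refine Finset.sum_congr rfl fun j _ => ?_
  rw [mul_comm, Complex.mul_conj, Complex.normSq_eq_norm_sq]
  push_cast
  rfl

/-- Bihomogeneity of degree `(p, q)` of a polynomial in `z` and `z̄`. -/
def IsBihomogeneous (p q : ℕ) (f : MvPolynomial (Fin n ⊕ Fin n) ℂ) : Prop :=
  MvPolynomial.IsWeightedHomogeneous (Sum.elim (fun _ => 1) (fun _ => 0) : Fin n ⊕ Fin n → ℕ) f p ∧
  MvPolynomial.IsWeightedHomogeneous (Sum.elim (fun _ => 0) (fun _ => 1) : Fin n ⊕ Fin n → ℕ) f q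

theorem pderiv_eq_zero_of_isWeightedHomogeneous_zero {σ : Type*} {w : σ → ℕ}
    {f : MvPolynomial σ ℂ} (hf : MvPolynomial.IsWeightedHomogeneous w f 0) {i : σ}
    (hi : w i ≠ 0) : MvPolynomial.pderiv i f = 0 := by
  refine MvPolynomial.pderiv_eq_zero_of_notMem_vars fun h => ?_
  obtain ⟨s, hs, his⟩ := (MvPolynomial.mem_vars_iff_mem_support i).mp h
  have h0 := hf (MvPolynomial.mem_support_iff.mp hs)
  have := Finsupp.le_weight w hi s
  rw [h0] at this
  exact (Finsupp.mem_support_iff.mp his) (by omega)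

theorem IsBihomogeneous.holDeriv {p q : ℕ} {f : MvPolynomial (Fin n ⊕ Fin n) ℂ}
    (hf : IsBihomogeneous (p + 1) q f) (z : EuclideanSpace ℂ (Fin n)) :
    IsBihomogeneous p q (holDeriv z f) := by
  rw [holDeriv_apply]
  constructor <;>
  refine MvPolynomial.IsWeightedHomogeneous.sum _ _ _ fun j _ => ?_ <;>
  rw [← MvPolynomial.mem_weightedHomogeneousSubmodule] <;>
  refine Submodule.smul_mem _ _ ?_ <;>
  rw [MvPolynomial.mem_weightedHomogeneousSubmodule]
  · exact hf.1.pderiv (by simp)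
  · exact hf.2.pderiv (by simp)

theorem IsBihomogeneous.antiholDeriv {p q : ℕ} {f : MvPolynomial (Fin n ⊕ Fin n) ℂ}
    (hf : IsBihomogeneous p (q + 1) f) (z : EuclideanSpace ℂ (Fin n)) :
    IsBihomogeneous p q (antiholDeriv z f) := by
  rw [antiholDeriv_apply]
  constructor <;>
  refine MvPolynomial.IsWeightedHomogeneous.sum _ _ _ fun j _ => ?_ <;>
  rw [← MvPolynomial.mem_weightedHomogeneousSubmodule] <;>
  refine Submodule.smul_mem _ _ ?_ <;>
  rw [MvPolynomial.mem_weightedHomogeneousSubmodule]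
  · exact hf.1.pderiv (by simp)
  · exact hf.2.pderiv (by simp)

theorem IsBihomogeneous.holDeriv_eq_zero {q : ℕ} {f : MvPolynomial (Fin n ⊕ Fin n) ℂ}
    (hf : IsBihomogeneous 0 q f) (z : EuclideanSpace ℂ (Fin n)) : _root_.holDeriv z f = 0 := by
  rw [holDeriv_apply]
  refine Finset.sum_eq_zero fun j _ => ?_
  rw [pderiv_eq_zero_of_isWeightedHomogeneous_zero hf.1 (by simp), smul_zero]

theorem IsBihomogeneous.antiholDeriv_eq_zero {p : ℕ} {f : MvPolynomial (Fin n ⊕ Fin n) ℂ}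
    (hf : IsBihomogeneous p 0 f) (z : EuclideanSpace ℂ (Fin n)) :
    _root_.antiholDeriv z f = 0 := by
  rw [antiholDeriv_apply]
  refine Finset.sum_eq_zero fun j _ => ?_
  rw [pderiv_eq_zero_of_isWeightedHomogeneous_zero hf.2 (by simp), smul_zero]

theorem IsBihomogeneous.sum_X_inl {p q : ℕ} {f : MvPolynomial (Fin n ⊕ Fin n) ℂ}
    (hf : IsBihomogeneous p q f) :
    ∑ j, MvPolynomial.X (Sum.inl j) * MvPolynomial.pderiv (Sum.inl j) f = (p : ℂ) • f := by
  have := hf.1.sum_weight_X_mul_pderiv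
  simpa [Fintype.sum_sum_type, Nat.cast_smul_eq_nsmul] using this

theorem IsBihomogeneous.sum_X_inr {p q : ℕ} {f : MvPolynomial (Fin n ⊕ Fin n) ℂ}
    (hf : IsBihomogeneous p q f) :
    ∑ j, MvPolynomial.X (Sum.inr j) * MvPolynomial.pderiv (Sum.inr j) f = (q : ℂ) • f := by
  have := hf.2.sum_weight_X_mul_pderiv
  simpa [Fintype.sum_sum_type, Nat.cast_smul_eq_nsmul] using this

theorem IsBihomogeneous.polyFun_holDeriv {p q : ℕ} {f : MvPolynomial (Fin n ⊕ Fin n) ℂ}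
    (hf : IsBihomogeneous p q f) (z : EuclideanSpace ℂ (Fin n)) :
    polyFun (_root_.holDeriv z f) z = p * polyFun f z := by
  rw [← polyFun_smul, ← hf.sum_X_inl, holDeriv_apply, polyFun_sum, polyFun_sum]
  simp

theorem IsBihomogeneous.polyFun_antiholDeriv {p q : ℕ} {f : MvPolynomial (Fin n ⊕ Fin n) ℂ}
    (hf : IsBihomogeneous p q f) (z : EuclideanSpace ℂ (Fin n)) :
    polyFun (_root_.antiholDeriv z f) z = q * polyFun f z := by
  rw [← polyFun_smul, ← hf.sum_X_inr, antiholDeriv_apply, polyFun_sum, polyFun_sum]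
  simp

/-- Weak harmonicity: `∑ ∂̄_j ∂_j f` is orthogonal to all polynomials in the Gaussian space. -/
def IsGaussHarmonic (f : MvPolynomial (Fin n ⊕ Fin n) ℂ) : Prop :=
  ∀ h, gaussInt (h * boxOp f) = 0

theorem boxOp_holDeriv (z : EuclideanSpace ℂ (Fin n)) (f : MvPolynomial (Fin n ⊕ Fin n) ℂ) :
    boxOp (holDeriv z f) = holDeriv z (boxOp f) := by
  simp_rw [boxOp, holDeriv_apply, map_sum, Derivation.map_smul, Finset.smul_sum]
  rw [Finset.sum_comm]
  refine Finset.sum_congr rfl fun j _ => Finset.sum_congr rfl fun i _ => ?_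
  rw [pderiv_pderiv_comm (Sum.inl i) (Sum.inl j), pderiv_pderiv_comm (Sum.inr i) (Sum.inl j)]

theorem boxOp_antiholDeriv (z : EuclideanSpace ℂ (Fin n)) (f : MvPolynomial (Fin n ⊕ Fin n) ℂ) :
    boxOp (antiholDeriv z f) = antiholDeriv z (boxOp f) := by
  simp_rw [boxOp, antiholDeriv_apply, map_sum, Derivation.map_smul, Finset.smul_sum]
  rw [Finset.sum_comm]
  refine Finset.sum_congr rfl fun j _ => Finset.sum_congr rfl fun i _ => ?_
  rw [pderiv_pderiv_comm (Sum.inl i) (Sum.inr j), pderiv_pderiv_comm (Sum.inr i) (Sum.inr j)]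

/-- Integrating `z · ∂` by parts moves it onto the test polynomial `h` or into a factor `w̄ · z`,
and both results are again tested against `boxOp f`. -/
theorem IsGaussHarmonic.holDeriv {f : MvPolynomial (Fin n ⊕ Fin n) ℂ} (hf : IsGaussHarmonic f)
    (z : EuclideanSpace ℂ (Fin n)) : IsGaussHarmonic (holDeriv z f) := by
  intro h
  have h1 := gaussInt_holDeriv z (h * boxOp f)
  rw [Derivation.leibniz, map_add, ← mul_assoc, hf, smul_eq_mul, smul_eq_mul,
    mul_comm (boxOp f), hf, add_zero] at h1
  rw [boxOp_holDeriv, h1]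

theorem IsGaussHarmonic.antiholDeriv {f : MvPolynomial (Fin n ⊕ Fin n) ℂ} (hf : IsGaussHarmonic f)
    (z : EuclideanSpace ℂ (Fin n)) : IsGaussHarmonic (antiholDeriv z f) := by
  intro h
  have h1 := gaussInt_antiholDeriv z (h * boxOp f)
  rw [Derivation.leibniz, map_add, ← mul_assoc, hf, smul_eq_mul, smul_eq_mul,
    mul_comm (boxOp f), hf, add_zero] at h1
  rw [boxOp_antiholDeriv, h1]

/-- The coefficient in the Funk–Hecke type formula `gaussInt_mul_pow_mul_pow`. -/
noncomputable def momentCoeff (p q a b : ℕ) (ρ : ℂ) : ℂ :=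
  if q ≤ a ∧ p + a = q + b then
    a.factorial * b.factorial / (a - q).factorial * ρ ^ (a - q) else 0

/-- By Euler's identity and integration by parts, `p ∫ f = ∫ ∑ z_j ∂_j f = ∫ ∑ ∂̄_j ∂_j f = 0`, and
likewise with `q`. So only constants have a nonzero Gaussian integral. -/
theorem IsGaussHarmonic.gaussInt_eq {p q : ℕ} {f : MvPolynomial (Fin n ⊕ Fin n) ℂ}
    (hf : IsGaussHarmonic f) (hpq : IsBihomogeneous p q f) (z : EuclideanSpace ℂ (Fin n)) (ρ : ℂ) :
    gaussInt f = (Real.pi : ℂ) ^ n * momentCoeff p q 0 0 ρ * polyFun f z := by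
  have hp : (p : ℂ) * gaussInt f = 0 := by
    have h1 := hf 1
    rw [one_mul, boxOp, map_sum] at h1
    simp_rw [gaussInt_pderiv_inr] at h1
    rwa [← map_sum, hpq.sum_X_inl, map_smul, smul_eq_mul] at h1
  have hq : (q : ℂ) * gaussInt f = 0 := by
    have h1 := hf 1
    rw [one_mul, boxOp, map_sum] at h1
    simp_rw [fun j : Fin n => pderiv_pderiv_comm (Sum.inr j) (Sum.inl j) f,
      gaussInt_pderiv_inl] at h1
    rwa [← map_sum, hpq.sum_X_inr, map_smul, smul_eq_mul] at h1
  by_cases h : p = 0 ∧ q = 0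
  · obtain ⟨rfl, rfl⟩ := h
    have hc : f = MvPolynomial.C (f.coeff 0) := by
      ext s
      rw [MvPolynomial.coeff_C]
      split_ifs with hs
      · rw [hs]
      · by_contra hne
        apply hs
        ext i
        rcases i with i | i
        · have := Finsupp.le_weight (Sum.elim (fun _ => 1) (fun _ => 0) : Fin n ⊕ Fin n → ℕ)
            (s := Sum.inl i) (by simp) s
          rw [hpq.1 hne] at this
          simp only [Finsupp.coe_zero, Pi.zero_apply]; omega
        · have := Finsupp.le_weight (Sum.elim (fun _ => 0) (fun _ => 1) : Fin n ⊕ Fin n → ℕ)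
            (s := Sum.inr i) (by simp) s
          rw [hpq.2 hne] at this
          simp only [Finsupp.coe_zero, Pi.zero_apply]; omega
    rw [hc, polyFun_C, ← mul_one (MvPolynomial.C _), ← MvPolynomial.smul_eq_C_mul, map_smul,
      gaussInt_one]
    simp [momentCoeff, mul_comm]
  · have h0 : gaussInt f = 0 := by
      rcases Nat.eq_zero_or_pos p with h1 | h1
      · have : (q : ℂ) ≠ 0 := by
          norm_cast; tauto
        exact (mul_eq_zero.mp hq).resolve_left this
      · exact (mul_eq_zero.mp hp).resolve_left (by norm_cast; omega)
    rw [h0, momentCoeff, if_neg (by omega)]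
    simp

/-- This and the next three lemmas are the recursions that the Leibniz rule imposes on the moments
when a factor `w̄ · z` or `w · z̄` is integrated by parts. -/
theorem momentCoeff_zero_zero_succ (q b : ℕ) (ρ : ℂ) : momentCoeff 0 q 0 (b + 1) ρ = 0 := by
  rw [momentCoeff, if_neg (by omega)]

theorem momentCoeff_succ_zero_succ (p q b : ℕ) (ρ : ℂ) :
    momentCoeff (p + 1) q 0 (b + 1) ρ = momentCoeff p q 0 b ρ * ((p + 1 : ℕ) : ℂ) := by
  unfold momentCoeff
  by_cases h : q ≤ 0 ∧ p + 0 = q + b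
  · rw [if_pos h, if_pos (by omega)]
    obtain ⟨h1, h2⟩ := h
    obtain rfl : q = 0 := by omega
    obtain rfl : p = b := by omega
    rw [Nat.factorial_succ]
    push_cast
    simp
    ring
  · rw [if_neg h, if_neg (by omega), zero_mul]

theorem momentCoeff_zero_succ (p a b : ℕ) (ρ : ℂ) :
    momentCoeff p 0 (a + 1) b ρ = ρ * b * momentCoeff p 0 a (b - 1) ρ := by
  have := Nat.cast_ne_zero (R := ℂ).mpr a.factorial_ne_zero
  have := Nat.cast_ne_zero (R := ℂ).mpr (a + 1).factorial_ne_zero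
  unfold momentCoeff
  cases b with
  | zero => rw [if_neg (by omega)]; simp
  | succ b =>
    by_cases h : p + a = b
    · rw [if_pos (by omega), if_pos (by omega), Nat.factorial_succ b]
      simp only [Nat.sub_zero, Nat.add_sub_cancel]
      push_cast
      field_simp
      ring
    · rw [if_neg (by omega), if_neg (by omega), mul_zero]

theorem momentCoeff_succ_succ (p q a b : ℕ) (ρ : ℂ) :
    momentCoeff p (q + 1) (a + 1) b ρ =
      momentCoeff p q a b ρ * ((q + 1 : ℕ) : ℂ) + ρ * b * momentCoeff p (q + 1) a (b - 1) ρ := by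
  have fne : ∀ l : ℕ, (l.factorial : ℂ) ≠ 0 := fun l => Nat.cast_ne_zero.mpr l.factorial_ne_zero
  unfold momentCoeff
  by_cases h : q ≤ a ∧ p + a = q + b
  · rw [if_pos (by omega), if_pos h]
    obtain ⟨j, rfl⟩ := Nat.exists_eq_add_of_le h.1
    cases j with
    | zero =>
      rw [if_neg (by omega)]
      simp [Nat.factorial_succ]
      ring
    | succ j =>
      obtain rfl : b = p + j + 1 := by omega
      rw [if_pos (by omega), show q + (j + 1) - q = j + 1 by omega,
        show q + (j + 1) + 1 - (q + 1) = j + 1 by omega,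
        show q + (j + 1) - (q + 1) = j by omega, Nat.add_sub_cancel,
        Nat.factorial_succ (q + (j + 1)), Nat.factorial_succ j, Nat.factorial_succ (p + j)]
      have := fne j
      have : (j + 1 : ℂ) ≠ 0 := Nat.cast_add_one_ne_zero j
      push_cast
      field_simp
      ring
  · rw [if_neg (by omega), if_neg h]
    by_cases hb : b = 0
    · simp [hb]
    · rw [if_neg (by omega)]
      simp

/-- The Gaussian moments of a bigraded harmonic polynomial against `(w · z̄)^a (w̄ · z)^b`. -/
theorem IsGaussHarmonic.gaussInt_mul_pow_mul_pow {p q : ℕ} {f : MvPolynomial (Fin n ⊕ Fin n) ℂ}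
    (hf : IsGaussHarmonic f) (hpq : IsBihomogeneous p q f) (z : EuclideanSpace ℂ (Fin n))
    (a b : ℕ) :
    gaussInt (f * holLin z ^ a * antiholLin z ^ b) =
      (Real.pi : ℂ) ^ n * momentCoeff p q a b ((‖z‖ ^ 2 : ℝ) : ℂ) * polyFun f z := by
  induction a generalizing p q f b with
  | zero =>
    induction b generalizing p q f with
    | zero => simpa using hf.gaussInt_eq hpq z _
    | succ b ih =>
      have h1 := gaussInt_holDeriv z (f * holLin z ^ 0 * antiholLin z ^ b)
      -- With exponent `0` on `holLin z`, the derivative falls on `f` alone, because `z · ∂` kills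
      -- `w̄ · z`.
      have h2 : _root_.holDeriv z (f * holLin z ^ 0 * antiholLin z ^ b) =
          _root_.holDeriv z f * holLin z ^ 0 * antiholLin z ^ b := by
        simp [Derivation.leibniz, Derivation.leibniz_pow, holDeriv_antiholLin, mul_comm]
      rw [h2] at h1
      rw [show f * holLin z ^ 0 * antiholLin z ^ (b + 1) =
        antiholLin z * (f * holLin z ^ 0 * antiholLin z ^ b) by ring, ← h1]
      cases p with
      | zero => rw [hpq.holDeriv_eq_zero, momentCoeff_zero_zero_succ]; simp
      | succ p =>
        rw [ih (hf.holDeriv z) (hpq.holDeriv z), hpq.polyFun_holDeriv, momentCoeff_succ_zero_succ]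
        ring
  | succ a ih =>
    have h1 := gaussInt_antiholDeriv z (f * holLin z ^ a * antiholLin z ^ b)
    -- Here `z̄ · ∂̄` kills `w · z̄` but sends `w̄ · z` to `|z|²`; this second term is the source of
    -- the powers of `ρ`.
    have h2 : _root_.antiholDeriv z (f * holLin z ^ a * antiholLin z ^ b) =
        _root_.antiholDeriv z f * holLin z ^ a * antiholLin z ^ b +
          (((‖z‖ ^ 2 : ℝ) : ℂ) * b) • (f * holLin z ^ a * antiholLin z ^ (b - 1)) := by
      rw [Derivation.leibniz, Derivation.leibniz, Derivation.leibniz_pow, Derivation.leibniz_pow,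
        antiholDeriv_holLin, antiholDeriv_antiholLin]
      simp only [smul_eq_mul, nsmul_eq_mul, MvPolynomial.smul_eq_C_mul,
        map_mul, map_natCast]
      ring
    rw [h2, map_add, map_smul, ih hf hpq] at h1
    rw [show f * holLin z ^ (a + 1) * antiholLin z ^ b =
      holLin z * (f * holLin z ^ a * antiholLin z ^ b) by ring, ← h1]
    cases q with
    | zero =>
      rw [hpq.antiholDeriv_eq_zero, momentCoeff_zero_succ, smul_eq_mul]
      simp only [zero_mul, map_zero]
      ring
    | succ q =>
      rw [ih (hf.antiholDeriv z) (hpq.antiholDeriv z), hpq.polyFun_antiholDeriv,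
        momentCoeff_succ_succ, smul_eq_mul]
      ring

end

/-! ### Solid harmonics as polynomials, and polar coordinates -/

section

variable {n : ℕ}

theorem fderiv_fderiv_polyFun (f : MvPolynomial (Fin n ⊕ Fin n) ℂ)
    (z v : EuclideanSpace ℂ (Fin n)) :
    fderiv ℝ (fderiv ℝ (polyFun f)) z v v =
      ∑ i, ∑ k, polyFun (MvPolynomial.pderiv k (MvPolynomial.pderiv i f)) z *
        (coordCLM k v * coordCLM i v) := by
  have h1 : fderiv ℝ (polyFun f) =
      fun z => ∑ i, polyFun (MvPolynomial.pderiv i f) z • coordCLM i :=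
    funext fun z => (hasFDerivAt_polyFun f z).fderiv
  have h2 := HasFDerivAt.fun_sum (u := Finset.univ) fun (i : Fin n ⊕ Fin n) _ =>
    (hasFDerivAt_polyFun (MvPolynomial.pderiv i f) z).smul_const (coordCLM (n := n) i)
  rw [h1, h2.fderiv]
  simp only [sum_apply, ContinuousLinearMap.smulRight_apply, smul_apply, smul_eq_mul,
    Finset.sum_mul, mul_assoc]

theorem laplacian_polyFun (f : MvPolynomial (Fin n ⊕ Fin n) ℂ) (z : EuclideanSpace ℂ (Fin n)) :
    Laplacian.laplacian (polyFun f) z = 4 * polyFun (boxOp f) z := by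
  rw [InnerProductSpace.laplacian_eq_iteratedFDeriv_orthonormalBasis (polyFun f)
    (Pi.orthonormalBasis fun _ : Fin n => Complex.orthonormalBasisOneI)]
  simp only [iteratedFDeriv_two_apply, Matrix.cons_val_zero, Matrix.cons_val_one,
    Pi.orthonormalBasis_apply]
  simp_rw [fderiv_fderiv_polyFun]
  rw [Fintype.sum_sigma]
  -- The real directions `1` and `i` give `(∂ + ∂̄)² - (∂ - ∂̄)² = 4 ∂∂̄` in each coordinate.
  have key : ∀ j : Fin n, ∑ y : Fin 2, ∑ i, ∑ k,
      polyFun (MvPolynomial.pderiv k (MvPolynomial.pderiv i f)) z *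
        (coordCLM k (PiLp.single 2 j (Complex.orthonormalBasisOneI y)) *
          coordCLM i (PiLp.single 2 j (Complex.orthonormalBasisOneI y))) =
      4 * polyFun (MvPolynomial.pderiv (Sum.inr j) (MvPolynomial.pderiv (Sum.inl j) f)) z := by
    intro j
    have hl : ∀ (i : Fin n) (c : ℂ), coordCLM (Sum.inl i) (PiLp.single 2 j c) =
        if i = j then c else 0 := fun i c => by simp [PiLp.single_apply]
    have hr : ∀ (i : Fin n) (c : ℂ), coordCLM (Sum.inr i) (PiLp.single 2 j c) =
        if i = j then (starRingEnd ℂ) c else 0 := fun i c => by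
      simp only [coordCLM_inr, PiLp.single_apply]; split_ifs <;> simp
    simp only [Fintype.sum_sum_type, hl, hr, Fin.sum_univ_two, mul_ite, mul_zero, ite_mul,
      zero_mul, Finset.sum_ite_eq', Finset.mem_univ, if_true, Finset.sum_add_distrib]
    rw [pderiv_pderiv_comm (Sum.inl j) (Sum.inr j)]
    simp [Complex.coe_orthonormalBasisOneI]
    ring
  simp_rw [key]
  rw [← Finset.mul_sum, boxOp, polyFun_sum]

theorem IsSolidHarmonic.exists_polyFun {p q : ℕ} {P : EuclideanSpace ℂ (Fin n) → ℂ}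
    (hP : IsSolidHarmonic p q P) :
    ∃ f : MvPolynomial (Fin n ⊕ Fin n) ℂ,
      IsBihomogeneous p q f ∧ IsGaussHarmonic f ∧ P = polyFun f := by
  obtain ⟨hharm, c, hc⟩ := hP
  let f : MvPolynomial (Fin n ⊕ Fin n) ℂ :=
    ∑ α ∈ Finset.piAntidiag Finset.univ p, ∑ β ∈ Finset.piAntidiag Finset.univ q,
      MvPolynomial.C (c α β) * (∏ j, MvPolynomial.X (Sum.inl j) ^ α j) *
        ∏ j, MvPolynomial.X (Sum.inr j) ^ β j
  have hPf : P = polyFun f := by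
    funext z
    rw [hc]
    simp [f, polyFun_prod]
  have hhom : ∀ (w : Fin n ⊕ Fin n → ℕ) (d : ℕ),
      (∀ α ∈ Finset.piAntidiag (Finset.univ : Finset (Fin n)) p,
        ∀ β ∈ Finset.piAntidiag (Finset.univ : Finset (Fin n)) q,
        ∑ j, α j • w (Sum.inl j) + ∑ j, β j • w (Sum.inr j) = d) →
      MvPolynomial.IsWeightedHomogeneous w f d := by
    intro w d h
    refine MvPolynomial.IsWeightedHomogeneous.sum _ _ _ fun α hα => ?_
    refine MvPolynomial.IsWeightedHomogeneous.sum _ _ _ fun β hβ => ?_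
    rw [← h α hα β hβ]
    refine MvPolynomial.IsWeightedHomogeneous.mul ?_ ?_
    · rw [← zero_add (∑ j, _)]
      refine (MvPolynomial.isWeightedHomogeneous_C w _).mul ?_
      exact MvPolynomial.IsWeightedHomogeneous.prod _ _ _ fun j _ =>
        (MvPolynomial.isWeightedHomogeneous_X ℂ w _).pow _
    · exact MvPolynomial.IsWeightedHomogeneous.prod _ _ _ fun j _ =>
        (MvPolynomial.isWeightedHomogeneous_X ℂ w _).pow _
  refine ⟨f, ⟨hhom _ _ fun α hα β hβ => ?_, hhom _ _ fun α hα β hβ => ?_⟩, fun h => ?_, hPf⟩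
  · simpa using (Finset.mem_piAntidiag.mp hα).1
  · simpa using (Finset.mem_piAntidiag.mp hβ).1
  · rw [gaussInt_apply]
    -- Vanishing as a function is enough for the weak condition; `boxOp f = 0` as a polynomial is
    -- not needed.
    have : ∀ z, polyFun (boxOp f) z = 0 := by
      intro z
      have h1 := (hharm z trivial).2.self_of_nhds
      rw [hPf, laplacian_polyFun] at h1
      simpa using h1
    simp [this]

/-- The polar parametrization of `Heis n`. -/
noncomputable def polarMap (n : ℕ)
    (x : Metric.sphere (0 : EuclideanSpace ℂ (Fin n)) 1 × (Set.Ioi (0 : ℝ) × ℝ)) : Heis n :=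
  ((x.2.1 : ℝ) • (x.1 : EuclideanSpace ℂ (Fin n)), x.2.2)

/-- The polar parametrization of `ℂⁿ`. -/
noncomputable def polarMapC (n : ℕ)
    (x : Metric.sphere (0 : EuclideanSpace ℂ (Fin n)) 1 × Set.Ioi (0 : ℝ)) :
    EuclideanSpace ℂ (Fin n) :=
  (x.2 : ℝ) • (x.1 : EuclideanSpace ℂ (Fin n))

theorem measurableEmbedding_polarMapC (n : ℕ) : MeasurableEmbedding (polarMapC n) :=
  (MeasurableEmbedding.subtype_coe (measurableSet_singleton _).compl).comp
    (homeomorphUnitSphereProd (EuclideanSpace ℂ (Fin n))).symm.measurableEmbedding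

theorem measurePreserving_polarMapC (hn : 0 < n) :
    MeasurePreserving (polarMapC n)
      ((volume : Measure (EuclideanSpace ℂ (Fin n))).toSphere.prod
        (Measure.volumeIoiPow (2 * n - 1))) volume := by
  have : Nonempty (Fin n) := ⟨⟨0, hn⟩⟩
  have h1 := (volume : Measure (EuclideanSpace ℂ (Fin n))).measurePreserving_homeomorphUnitSphereProd
  rw [finrank_euclideanSpace_complex] at h1
  have h2 : MeasurePreserving
      (Subtype.val : ({0}ᶜ : Set (EuclideanSpace ℂ (Fin n))) → EuclideanSpace ℂ (Fin n))
      (volume.comap Subtype.val) volume := by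
    refine ⟨measurable_subtype_coe, ?_⟩
    rw [map_comap_subtype_coe (measurableSet_singleton _).compl]
    rw [Measure.restrict_eq_self_of_ae_mem]
    exact Measure.ae_ne volume 0
  have h3 : MeasurePreserving
      (homeomorphUnitSphereProd (EuclideanSpace ℂ (Fin n))).toMeasurableEquiv _ _ := h1
  exact h2.comp h3.symm

theorem measurableEmbedding_polarMap (n : ℕ) : MeasurableEmbedding (polarMap n) :=
  ((measurableEmbedding_polarMapC n).prodMap MeasurableEmbedding.id).comp
    (MeasurableEquiv.prodAssoc.symm.measurableEmbedding)

theorem measurePreserving_polarMap (hn : 0 < n) :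
    MeasurePreserving (polarMap n)
      ((volume : Measure (EuclideanSpace ℂ (Fin n))).toSphere.prod
        ((Measure.volumeIoiPow (2 * n - 1)).prod volume)) volume := by
  have h1 := (measurePreserving_polarMapC hn).prod (MeasurePreserving.id (volume : Measure ℝ))
  have h2 := measurePreserving_prodAssoc (volume : Measure (EuclideanSpace ℂ (Fin n))).toSphere
    (Measure.volumeIoiPow (2 * n - 1)) (volume : Measure ℝ)
  exact h1.comp (h2.symm MeasurableEquiv.prodAssoc)

end

theorem volumeIoiPow_add (k l : ℕ) :
    Measure.volumeIoiPow (k + l) =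
      (Measure.volumeIoiPow k).withDensity fun r => ENNReal.ofReal (r.1 ^ l) := by
  rw [Measure.volumeIoiPow, Measure.volumeIoiPow, ← withDensity_mul _ (by fun_prop) (by fun_prop)]
  congr 1
  funext r
  have : (0 : ℝ) ≤ r.1 := le_of_lt r.2
  rw [Pi.mul_apply, ← ENNReal.ofReal_mul (by positivity), pow_add]

/-- The radial measure `r^k dr dt` on `(0, ∞) × ℝ`. -/
noncomputable def radialMeasure (k : ℕ) : Measure (Set.Ioi (0 : ℝ) × ℝ) :=
  (Measure.volumeIoiPow k).prod volume

instance (k : ℕ) : SigmaFinite (radialMeasure k) := by unfold radialMeasure; infer_instance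

/-- With `l = 2(p + q)` this relates the radial measures of `ℍⁿ` and `ℍ^{n+p+q}`. -/
theorem radialMeasure_add (k l : ℕ) :
    radialMeasure (k + l) =
      (radialMeasure k).withDensity fun x => ENNReal.ofReal ((x.1 : ℝ) ^ l) := by
  rw [radialMeasure, volumeIoiPow_add, prod_withDensity_left (by fun_prop)]
  rfl

theorem integrable_radialMeasure_add_iff {k l : ℕ} {f : Set.Ioi (0 : ℝ) × ℝ → ℂ} :
    Integrable f (radialMeasure (k + l)) ↔
      Integrable (fun x => ((x.1 : ℝ) : ℂ) ^ l * f x) (radialMeasure k) := by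
  rw [radialMeasure_add, integrable_withDensity_iff_integrable_smul' (by fun_prop)
    (Filter.Eventually.of_forall fun x => ENNReal.ofReal_lt_top)]
  refine integrable_congr (Filter.Eventually.of_forall fun x => ?_)
  have : (0 : ℝ) ≤ x.1 := le_of_lt x.1.2
  simp only
  rw [ENNReal.toReal_ofReal (by positivity), Complex.real_smul]
  push_cast
  rfl

theorem integral_radialMeasure_add (k l : ℕ) (f : Set.Ioi (0 : ℝ) × ℝ → ℂ) :
    ∫ x, f x ∂(radialMeasure (k + l)) =
      ∫ x, ((x.1 : ℝ) : ℂ) ^ l * f x ∂(radialMeasure k) := by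
  rw [radialMeasure_add, integral_withDensity_eq_integral_toReal_smul (by fun_prop)
    (Filter.Eventually.of_forall fun x => ENNReal.ofReal_lt_top)]
  refine integral_congr_ae (Filter.Eventually.of_forall fun x => ?_)
  have : (0 : ℝ) ≤ x.1 := le_of_lt x.1.2
  simp only
  rw [ENNReal.toReal_ofReal (by positivity), Complex.real_smul]
  push_cast
  rfl

theorem integral_pow_mul_exp_volumeIoiPow (k N : ℕ) :
    ∫ r, (r : ℝ) ^ N * Real.exp (-(r : ℝ) ^ 2) ∂(Measure.volumeIoiPow k) =
      1 / 2 * Real.Gamma (((k + N : ℕ) + 1 : ℝ) / 2) := by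
  rw [Measure.volumeIoiPow, integral_withDensity_eq_integral_toReal_smul (by fun_prop)
    (Filter.Eventually.of_forall fun x => ENNReal.ofReal_lt_top),
    integral_subtype_comap measurableSet_Ioi fun r : ℝ =>
      (ENNReal.ofReal (r ^ k)).toReal • (r ^ N * Real.exp (-r ^ 2)),
    ← integral_rpow_mul_exp_neg_rpow two_pos
      (by have := Nat.cast_nonneg (α := ℝ) (k + N); linarith)]
  refine setIntegral_congr_fun measurableSet_Ioi fun r hr => ?_
  have hr' : (0 : ℝ) < r := hr
  rw [ENNReal.toReal_ofReal (by positivity), Real.rpow_natCast, pow_add, smul_eq_mul]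
  norm_num
  ring

/-! ### Moments on the unit sphere -/

section

variable {n : ℕ}

theorem IsBihomogeneous.polyFun_smul_real {p q : ℕ} {f : MvPolynomial (Fin n ⊕ Fin n) ℂ}
    (hf : IsBihomogeneous p q f) (r : ℝ) (z : EuclideanSpace ℂ (Fin n)) :
    polyFun f (r • z) = (r : ℂ) ^ (p + q) * polyFun f z := by
  unfold polyFun
  rw [MvPolynomial.eval_eq, MvPolynomial.eval_eq, Finset.mul_sum]
  refine Finset.sum_congr rfl fun s hs => ?_
  have hs' := MvPolynomial.mem_support_iff.mp hs
  have hw : ∀ w : Fin n ⊕ Fin n → ℕ, Finsupp.weight w s = ∑ i, s i * w i := by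
    intro w
    rw [Finsupp.weight_apply, Finsupp.sum_fintype _ _ (by simp)]
    simp
  have h1 := hf.1 hs'
  have h2 := hf.2 hs'
  rw [hw] at h1 h2
  have hsum : ∑ i ∈ s.support, s i = p + q := by
    rw [← h1, ← h2, ← Finset.sum_add_distrib]
    rw [Finset.sum_subset (Finset.subset_univ s.support) (fun i _ hi => by simpa using hi)]
    refine Finset.sum_congr rfl fun i _ => ?_
    rcases i with i | i <;> simp
  simp_rw [map_smul, Complex.real_smul, mul_pow]
  rw [Finset.prod_mul_distrib, Finset.prod_pow_eq_pow_sum, hsum]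
  ring

theorem polyFun_holLin_smul (z w : EuclideanSpace ℂ (Fin n)) (r : ℝ) :
    polyFun (holLin z) (r • w) = (r : ℂ) * polyFun (holLin z) w := by
  simp only [holLin, polyFun_sum, polyFun_smul, polyFun_X, map_smul, Complex.real_smul,
    Finset.mul_sum]
  exact Finset.sum_congr rfl fun j _ => by ring

theorem polyFun_antiholLin_smul (z w : EuclideanSpace ℂ (Fin n)) (r : ℝ) :
    polyFun (antiholLin z) (r • w) = (r : ℂ) * polyFun (antiholLin z) w := by
  simp only [antiholLin, polyFun_sum, polyFun_smul, polyFun_X, map_smul, Complex.real_smul,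
    Finset.mul_sum]
  exact Finset.sum_congr rfl fun j _ => by ring

/-- The Gaussian integral of a homogeneous polynomial in polar coordinates. -/
theorem gaussInt_eq_integral_sphere (hn : 0 < n) {N : ℕ} {h : MvPolynomial (Fin n ⊕ Fin n) ℂ}
    (hh : ∀ (r : ℝ) w, polyFun h (r • w) = (r : ℂ) ^ N * polyFun h w) :
    gaussInt h = (∫ ω : Metric.sphere (0 : EuclideanSpace ℂ (Fin n)) 1, polyFun h ω
      ∂(volume : Measure (EuclideanSpace ℂ (Fin n))).toSphere) *
      ((1 / 2 * Real.Gamma (((2 * n - 1 + N : ℕ) + 1 : ℝ) / 2) : ℝ) : ℂ) := by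
  rw [gaussInt_apply, ← (measurePreserving_polarMapC hn).integral_comp
    (measurableEmbedding_polarMapC n), ← integral_pow_mul_exp_volumeIoiPow,
    ← integral_complex_ofReal, ← integral_prod_mul]
  refine integral_congr_ae (Filter.Eventually.of_forall fun x => ?_)
  have hr : (0 : ℝ) < x.2.1 := x.2.2
  have hω : ‖(x.1 : EuclideanSpace ℂ (Fin n))‖ = 1 := by simp
  simp only [polarMapC, hh, norm_smul, hω, mul_one, Real.norm_eq_abs, sq_abs]
  push_cast
  ring

theorem IsGaussHarmonic.integral_sphere_mul_gamma {p q : ℕ} (hn : 0 < n)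
    {f : MvPolynomial (Fin n ⊕ Fin n) ℂ} (hf : IsGaussHarmonic f) (hpq : IsBihomogeneous p q f)
    (z : EuclideanSpace ℂ (Fin n)) (a b : ℕ) :
    (∫ ω : Metric.sphere (0 : EuclideanSpace ℂ (Fin n)) 1,
      polyFun f ω * polyFun (holLin z) ω ^ a * polyFun (antiholLin z) ω ^ b
      ∂(volume : Measure (EuclideanSpace ℂ (Fin n))).toSphere) *
      ((1 / 2 * Real.Gamma (((2 * n - 1 + (p + q + a + b) : ℕ) + 1 : ℝ) / 2) : ℝ) : ℂ) =
      (Real.pi : ℂ) ^ n * momentCoeff p q a b ((‖z‖ ^ 2 : ℝ) : ℂ) * polyFun f z := by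
  rw [← hf.gaussInt_mul_pow_mul_pow hpq, gaussInt_eq_integral_sphere hn (N := p + q + a + b)]
  · simp
  · intro r w
    simp only [polyFun_mul, polyFun_pow, hpq.polyFun_smul_real, polyFun_holLin_smul,
      polyFun_antiholLin_smul]
    ring

theorem IsGaussHarmonic.integral_sphere_eq_zero {p q : ℕ} (hn : 0 < n)
    {f : MvPolynomial (Fin n ⊕ Fin n) ℂ} (hf : IsGaussHarmonic f) (hpq : IsBihomogeneous p q f)
    (z : EuclideanSpace ℂ (Fin n)) {a b : ℕ} (hab : ¬ ∃ j, a = q + j ∧ b = p + j) :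
    ∫ ω : Metric.sphere (0 : EuclideanSpace ℂ (Fin n)) 1,
      polyFun f ω * polyFun (holLin z) ω ^ a * polyFun (antiholLin z) ω ^ b
      ∂(volume : Measure (EuclideanSpace ℂ (Fin n))).toSphere = 0 := by
  have h := hf.integral_sphere_mul_gamma hn hpq z a b
  rw [momentCoeff, if_neg (fun h => hab ⟨a - q, by omega, by omega⟩), mul_zero, zero_mul] at h
  refine (mul_eq_zero.mp h).resolve_right ?_
  refine Complex.ofReal_ne_zero.mpr ?_
  have := Real.Gamma_pos_of_pos
    (s := ((2 * n - 1 + (p + q + a + b) : ℕ) + 1 : ℝ) / 2) (by positivity)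
  positivity

theorem IsGaussHarmonic.integral_sphere_eq {p q : ℕ} (hn : 0 < n)
    {f : MvPolynomial (Fin n ⊕ Fin n) ℂ} (hf : IsGaussHarmonic f) (hpq : IsBihomogeneous p q f)
    (z : EuclideanSpace ℂ (Fin n)) (j : ℕ) :
    ∫ ω : Metric.sphere (0 : EuclideanSpace ℂ (Fin n)) 1,
      polyFun f ω * polyFun (holLin z) ω ^ (q + j) * polyFun (antiholLin z) ω ^ (p + j)
      ∂(volume : Measure (EuclideanSpace ℂ (Fin n))).toSphere =
    (q + j).factorial * (p + j).factorial * (2 * (Real.pi : ℂ) ^ n *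
      (((‖z‖ ^ 2 : ℝ) : ℂ) ^ j / (j.factorial * (n + p + q - 1 + j).factorial)) * polyFun f z) := by
  have h := hf.integral_sphere_mul_gamma hn hpq z (q + j) (p + j)
  -- The argument of Gamma is the integer `n + p + q + j`; positivity of `n` makes the truncated
  -- subtraction exact.
  have e : ((2 * n - 1 + (p + q + (q + j) + (p + j)) : ℕ) + 1 : ℝ) / 2 =
      (n + p + q - 1 + j : ℕ) + 1 := by
    have h1 : 2 * n - 1 + (p + q + (q + j) + (p + j)) + 1 = 2 * (n + p + q - 1 + j + 1) := by omega
    have h2 : ((2 * n - 1 + (p + q + (q + j) + (p + j)) : ℕ) + 1 : ℝ) =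
      2 * ((n + p + q - 1 + j : ℕ) + 1) := by exact_mod_cast h1
    rw [h2]
    ring
  rw [e, Real.Gamma_nat_eq_factorial, momentCoeff, if_pos (by omega), Nat.add_sub_cancel_left] at h
  have h1 := Nat.cast_ne_zero (R := ℂ).mpr (n + p + q - 1 + j).factorial_ne_zero
  have h2 := Nat.cast_ne_zero (R := ℂ).mpr j.factorial_ne_zero
  rw [← mul_left_inj' h1]
  push_cast at h ⊢
  field_simp at h ⊢
  linear_combination h

theorem toSphere_real_univ (hn : 0 < n) :
    (((volume : Measure (EuclideanSpace ℂ (Fin n))).toSphere.real Set.univ : ℝ) : ℂ) =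
      2 * (Real.pi : ℂ) ^ n / (n - 1).factorial := by
  have h := gaussInt_eq_integral_sphere hn (N := 0) (h := 1) (by simp)
  rw [gaussInt_one] at h
  have e : ((2 * n - 1 + 0 : ℕ) + 1 : ℝ) / 2 = (n - 1 : ℕ) + 1 := by
    have h1 : 2 * n - 1 + 0 + 1 = 2 * (n - 1 + 1) := by omega
    have h2 : ((2 * n - 1 + 0 : ℕ) + 1 : ℝ) = 2 * ((n - 1 : ℕ) + 1) := by exact_mod_cast h1
    rw [h2]
    ring
  rw [e, Real.Gamma_nat_eq_factorial] at h
  simp only [polyFun_one, integral_const, Complex.real_smul, mul_one] at h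
  have h1 := Nat.cast_ne_zero (R := ℂ).mpr (n - 1).factorial_ne_zero
  rw [eq_div_iff h1, h]
  push_cast
  ring

end

/-! ### The kernel and its spherical integral -/

section

variable {n : ℕ}

theorem polyFun_antiholLin_eq_conj (z w : EuclideanSpace ℂ (Fin n)) :
    polyFun (antiholLin z) w = (starRingEnd ℂ) (polyFun (holLin z) w) := by
  simp [antiholLin, holLin]

theorem norm_sub_sq_eq_polyFun (z w : EuclideanSpace ℂ (Fin n)) :
    ((‖z - w‖ ^ 2 : ℝ) : ℂ) =
      ((‖z‖ ^ 2 + ‖w‖ ^ 2 : ℝ) : ℂ) - polyFun (holLin z) w - polyFun (antiholLin z) w := by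
  rw [@norm_sub_sq_real, PiLp.inner_apply]
  simp only [holLin, antiholLin, polyFun_sum, polyFun_smul, polyFun_X, coordCLM_inl, coordCLM_inr,
    Complex.inner]
  rw [sub_sub, ← Finset.sum_add_distrib]
  push_cast
  rw [Finset.mul_sum, add_sub_right_comm]
  congr 2
  refine Finset.sum_congr rfl fun j _ => ?_
  apply Complex.ext <;> simp <;> ring

/-- The kernel of the Strichartz Fourier transform in terms of `w · z̄` and its conjugate. -/
theorem fanE_heisMul_heisInv {k : ℕ} {lam : ℝ} (hlam : lam ≠ 0)
    (w z : EuclideanSpace ℂ (Fin n)) (s : ℝ) :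
    fanE n (lam, (2 * (k : ℝ) + (n : ℝ)) * |lam|) (heisMul (heisInv (w, s)) (z, 0)) =
      Complex.exp (Complex.I * lam * ((-s : ℝ) : ℂ)) *
        ((Real.exp (-(1 / 4) * |lam| * (‖z‖ ^ 2 + ‖w‖ ^ 2)) : ℂ) *
        (Complex.exp (((|lam| / 2 : ℝ) : ℂ) *
          (if 0 < lam then polyFun (antiholLin z) w else polyFun (holLin z) w)) *
        laguerreSum (k + (n - 1)) (n - 1) (((|lam| / 2 * (‖z‖ ^ 2 + ‖w‖ ^ 2) : ℝ) : ℂ) -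
          ((|lam| / 2 : ℝ) : ℂ) * polyFun (holLin z) w -
          ((|lam| / 2 : ℝ) : ℂ) * polyFun (antiholLin z) w))) := by
  have hidx : fanIndex n (lam, (2 * (k : ℝ) + (n : ℝ)) * |lam|) = k :=
    fanIndex_of_mem hlam rfl
  have hN := norm_sub_sq_eq_polyFun z w
  have him : ((∑ j, (-w) j * (starRingEnd ℂ) (z j)).im : ℂ) =
      Complex.I / 2 * (polyFun (holLin z) w - polyFun (antiholLin z) w) := by
    have : ∑ j, (-w) j * (starRingEnd ℂ) (z j) = - polyFun (holLin z) w := by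
      simp [holLin, mul_comm]
    rw [this, polyFun_antiholLin_eq_conj, Complex.sub_conj, Complex.neg_im]
    push_cast
    linear_combination -((polyFun (holLin z) w).im : ℂ) * Complex.I_sq
  have harg : ((1 / 2 * |lam| * ‖z - w‖ ^ 2 : ℝ) : ℂ) =
      ((|lam| / 2 * (‖z‖ ^ 2 + ‖w‖ ^ 2) : ℝ) : ℂ) -
          ((|lam| / 2 : ℝ) : ℂ) * polyFun (holLin z) w -
          ((|lam| / 2 : ℝ) : ℂ) * polyFun (antiholLin z) w := by
    rw [Complex.ofReal_mul, hN]
    push_cast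
    ring
  have hexp2 : ((-(1 / 4) * |lam| * ‖z - w‖ ^ 2 : ℝ) : ℂ) =
      ((-(1 / 4) * |lam| * (‖z‖ ^ 2 + ‖w‖ ^ 2) : ℝ) : ℂ) +
        ((|lam| / 4 : ℝ) : ℂ) * (polyFun (holLin z) w + polyFun (antiholLin z) w) := by
    rw [Complex.ofReal_mul, hN]
    push_cast
    ring
  simp only [fanE, hidx, laguerreE, heisMul, heisInv, laguerrePhi, Int.natCast_nonneg, if_true,
    Int.toNat_natCast]
  rw [neg_add_eq_sub w z, Complex.ofReal_mul (laguerreL _ _ _), ofReal_laguerreL, harg,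
    Complex.ofReal_exp, Complex.ofReal_exp, hexp2]
  have : ∀ L e1 e2 e3 e4 e5 : ℂ, e1 + e2 = e3 + (e4 + e5) →
      Complex.exp e1 * (L * Complex.exp e2) =
        Complex.exp e3 * (Complex.exp e4 * (Complex.exp e5 * L)) := by
    intro L e1 e2 e3 e4 e5 h
    have h' : Complex.exp e1 * Complex.exp e2 =
        Complex.exp e3 * (Complex.exp e4 * Complex.exp e5) := by
      rw [← Complex.exp_add, ← Complex.exp_add, ← Complex.exp_add, h]
    linear_combination L * h'
  apply this
  rw [add_zero, Complex.ofReal_add, Complex.ofReal_mul (1 / 2), him]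
  -- The exponent is `(|λ|/4)(A + B) - (λ/4)(A - B)` with `A = w · z̄` and `B = w̄ · z`, which is
  -- `(|λ|/2)B` or `(|λ|/2)A` according to the sign of `λ`.
  rcases lt_or_gt_of_ne hlam with h | h
  · rw [if_neg (not_lt.mpr h.le), abs_of_neg h]
    push_cast
    linear_combination (lam / 4 : ℂ) * (polyFun (holLin z) w - polyFun (antiholLin z) w) *
      Complex.I_sq
  · rw [if_pos h, abs_of_pos h]
    push_cast
    linear_combination (lam / 4 : ℂ) * (polyFun (holLin z) w - polyFun (antiholLin z) w) *
      Complex.I_sq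

/-- The spherical integral of a bigraded harmonic against the (reduced) kernel, for functions `A`,
`B` with the moments of `ω · z̄` and `ω̄ · z`. -/
theorem integral_sphere_mul_exp_mul_laguerreSum {k p q : ℕ} (hn : 0 < n)
    {P A B : EuclideanSpace ℂ (Fin n) → ℂ} (hPc : Continuous P) (hA : Continuous A)
    (hB : Continuous B) (z : EuclideanSpace ℂ (Fin n)) (κ r : ℝ)
    (hz : ∀ a b, (¬ ∃ j, a = q + j ∧ b = p + j) →
      ∫ ω : Metric.sphere (0 : EuclideanSpace ℂ (Fin n)) 1, P ω * A ω ^ a * B ω ^ b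
        ∂(volume : Measure (EuclideanSpace ℂ (Fin n))).toSphere = 0)
    (hc : ∀ j, ∫ ω : Metric.sphere (0 : EuclideanSpace ℂ (Fin n)) 1,
        P ω * A ω ^ (q + j) * B ω ^ (p + j)
        ∂(volume : Measure (EuclideanSpace ℂ (Fin n))).toSphere =
      (q + j).factorial * (p + j).factorial * (2 * (Real.pi : ℂ) ^ n *
      (((‖z‖ ^ 2 : ℝ) : ℂ) ^ j / (j.factorial * (n + p + q - 1 + j).factorial)) * P z)) :
    ∫ ω : Metric.sphere (0 : EuclideanSpace ℂ (Fin n)) 1,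
      P ω * Complex.exp (κ * (r * B ω)) * laguerreSum (k + (n - 1)) (n - 1)
        (((κ * (‖z‖ ^ 2 + r ^ 2) : ℝ) : ℂ) - κ * (r * A ω) - κ * (r * B ω))
        ∂(volume : Measure (EuclideanSpace ℂ (Fin n))).toSphere =
      2 * (Real.pi : ℂ) ^ n * P z * (κ * r) ^ (p + q) *
        if q ≤ k then ((k - q).factorial : ℂ) / (k - q + (n + p + q - 1)).factorial *
          laguerreSum (k - q + (n + p + q - 1)) (n + p + q - 1) ((κ * ‖z‖ ^ 2 : ℝ) : ℂ) *
          laguerreSum (k - q + (n + p + q - 1)) (n + p + q - 1) ((κ * r ^ 2 : ℝ) : ℂ)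
        else 0 := by
  have hscale : ∀ a b : ℕ, ∫ ω : Metric.sphere (0 : EuclideanSpace ℂ (Fin n)) 1,
      P ω * (κ * (r * A ω)) ^ a * (κ * (r * B ω)) ^ b
        ∂(volume : Measure (EuclideanSpace ℂ (Fin n))).toSphere =
      (κ * r : ℂ) ^ (a + b) * ∫ ω : Metric.sphere (0 : EuclideanSpace ℂ (Fin n)) 1,
        P ω * A ω ^ a * B ω ^ b
        ∂(volume : Measure (EuclideanSpace ℂ (Fin n))).toSphere := by
    intro a b
    rw [← integral_const_mul]
    congr 1
    funext ω
    ring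
  rw [integral_mul_exp_mul_laguerreSum (M := k + n + p + 1) (p := p) (q := q) (by omega)
    (h := fun ω : Metric.sphere (0 : EuclideanSpace ℂ (Fin n)) 1 => P ω)
    (A := fun ω : Metric.sphere (0 : EuclideanSpace ℂ (Fin n)) 1 => κ * (r * A ω))
    (B := fun ω : Metric.sphere (0 : EuclideanSpace ℂ (Fin n)) 1 => κ * (r * B ω))
    (by fun_prop) (by fun_prop) (by fun_prop) _
    (fun j => (κ * r : ℂ) ^ (q + j + (p + j)) * (2 * (Real.pi : ℂ) ^ n *
      (((‖z‖ ^ 2 : ℝ) : ℂ) ^ j / (j.factorial * (n + p + q - 1 + j).factorial)) * P z))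
    (fun a b hab => by rw [hscale, hz a b hab, mul_zero])
    (fun j => by rw [hscale, hc j]; ring)]
  split_ifs with hqk
  · rw [← sum_mul_laguerreSum_eq_mul (M := k + n + p + 1) (by omega), Finset.mul_sum]
    refine Finset.sum_congr rfl fun j _ => ?_
    -- The shift from degree `k` to `k - q` becomes visible here: with type `d = n + p + q - 1` the
    -- upper index is `(k - q) + d + j`, as in Bailey's formula.
    rw [show k + (n - 1) + p + j = k - q + (n + p + q - 1) + j by omega,
      show n - 1 + p + q + 2 * j = n + p + q - 1 + 2 * j by omega,
      show q + j + (p + j) = p + q + 2 * j by omega]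
    have e : ((κ * (‖z‖ ^ 2 + r ^ 2) : ℝ) : ℂ) =
        ((κ * ‖z‖ ^ 2 : ℝ) : ℂ) + ((κ * r ^ 2 : ℝ) : ℂ) := by push_cast; ring
    rw [e, pow_add, pow_mul]
    have e2 : (((κ * ‖z‖ ^ 2 : ℝ) : ℂ) * ((κ * r ^ 2 : ℝ) : ℂ)) ^ j =
        ((κ * r : ℂ) ^ 2) ^ j * ((‖z‖ ^ 2 : ℝ) : ℂ) ^ j := by
      rw [← mul_pow]; push_cast; ring
    rw [e2]
    ring
  · rw [mul_zero]
    refine Finset.sum_eq_zero fun j _ => ?_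
    -- For `k < q` the upper index `k + n - 1 + p + j` lies below the type `n - 1 + p + q + 2j`.
    rw [laguerreSum_eq_zero (by omega), mul_zero]

end

/-! ### Decay and integrability -/

/-- Laguerre functions decay faster than any power. -/
theorem exists_pow_mul_laguerreL_mul_exp_le (k d N : ℕ) :
    ∃ C : ℝ, ∀ x : ℝ, 0 ≤ x → x ^ N * |laguerreL k d x| * Real.exp (-(x / 2)) ≤ C := by
  have hpow : ∀ j : ℕ, ∀ x : ℝ, 0 ≤ x → x ^ j * Real.exp (-(x / 2)) ≤ 2 ^ j * j.factorial := by
    intro j x hx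
    have h := Real.pow_div_factorial_le_exp (x / 2) (by positivity) j
    rw [div_le_iff₀ (by positivity), div_pow, div_le_iff₀ (by positivity)] at h
    rw [Real.exp_neg, ← div_eq_mul_inv, div_le_iff₀ (Real.exp_pos _)]
    linarith
  refine ⟨∑ j ∈ Finset.range (k + 1), (Nat.choose (k + d) (k - j) : ℝ) / j.factorial *
    (2 ^ (N + j) * (N + j).factorial), fun x hx => ?_⟩
  have h1 : |laguerreL k d x| ≤ ∑ j ∈ Finset.range (k + 1),
      (Nat.choose (k + d) (k - j) : ℝ) / j.factorial * x ^ j := by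
    refine (Finset.abs_sum_le_sum_abs _ _).trans (Finset.sum_le_sum fun j _ => le_of_eq ?_)
    rw [abs_div, abs_mul, abs_mul, abs_pow, abs_neg, abs_one, one_pow, one_mul, abs_pow,
      abs_of_nonneg hx, Nat.abs_cast, Nat.abs_cast]
    ring
  calc _ ≤ x ^ N * (∑ j ∈ Finset.range (k + 1),
      (Nat.choose (k + d) (k - j) : ℝ) / j.factorial * x ^ j) * Real.exp (-(x / 2)) := by
        gcongr
    _ = ∑ j ∈ Finset.range (k + 1), (Nat.choose (k + d) (k - j) : ℝ) / j.factorial *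
      (x ^ (N + j) * Real.exp (-(x / 2))) := by
        rw [Finset.mul_sum, Finset.sum_mul]
        exact Finset.sum_congr rfl fun j _ => by ring
    _ ≤ _ := Finset.sum_le_sum fun j _ =>
        mul_le_mul_of_nonneg_left (hpow _ x hx) (by positivity)

theorem exists_pow_mul_laguerreE_le (d : ℕ) (k : ℤ) (N : ℕ) {lam : ℝ} (hlam : lam ≠ 0) :
    ∃ C : ℝ, ∀ r t : ℝ, 0 ≤ r → r ^ N * ‖laguerreE d k lam r t‖ ≤ C := by
  have hl : 0 < |lam| := abs_pos.mpr hlam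
  have hnorm : ∀ r t : ℝ, ‖laguerreE d k lam r t‖ = |laguerrePhi d k lam r| := by
    intro r t
    rw [laguerreE, norm_mul, Complex.norm_real, Real.norm_eq_abs, Complex.norm_exp]
    simp
  by_cases hk : 0 ≤ k
  · obtain ⟨C, hC⟩ := exists_pow_mul_laguerreL_mul_exp_le k.toNat d 0
    obtain ⟨C', hC'⟩ := exists_pow_mul_laguerreL_mul_exp_le k.toNat d N
    refine ⟨C + (2 / |lam|) ^ N * C', fun r t hr => ?_⟩
    set x : ℝ := 1 / 2 * |lam| * r ^ 2 with hx
    have hx0 : 0 ≤ x := by positivity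
    have h1 := hC x hx0
    have h2 := hC' x hx0
    have hphi : |laguerrePhi d k lam r| = |laguerreL k.toNat d x| * Real.exp (-(x / 2)) := by
      rw [laguerrePhi, if_pos hk, abs_mul, Real.abs_exp]
      congr 2
      rw [hx]; ring
    have hr2 : r ^ N ≤ 1 + (2 / |lam|) ^ N * x ^ N := by
      rw [← mul_pow]
      have : 2 / |lam| * x = r ^ 2 := by rw [hx]; field_simp
      rw [this, ← pow_mul, mul_comm 2 N, pow_mul]
      -- This is `u ≤ 1 + u²` with `u = r^N`, used because `x` controls only even powers of `r`.
      nlinarith [sq_nonneg (r ^ N - 1), sq_nonneg (r ^ N)]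
    rw [hnorm, hphi]
    calc _ ≤ (1 + (2 / |lam|) ^ N * x ^ N) *
        (|laguerreL k.toNat d x| * Real.exp (-(x / 2))) := by gcongr
      _ = x ^ 0 * |laguerreL k.toNat d x| * Real.exp (-(x / 2)) + (2 / |lam|) ^ N *
        (x ^ N * |laguerreL k.toNat d x| * Real.exp (-(x / 2))) := by ring
      _ ≤ _ := by gcongr
  · refine ⟨0, fun r t _ => ?_⟩
    rw [hnorm, laguerrePhi, if_neg hk]
    simp

theorem continuous_laguerreE (d : ℕ) (k : ℤ) (lam : ℝ) :
    Continuous fun x : ℝ × ℝ => laguerreE d k lam x.1 x.2 := by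
  unfold laguerreE laguerrePhi laguerreL
  split_ifs <;> fun_prop

section

variable {n : ℕ}

theorem polarMap_fst_norm (x : Metric.sphere (0 : EuclideanSpace ℂ (Fin n)) 1 ×
    (Set.Ioi (0 : ℝ) × ℝ)) : ‖(polarMap n x).1‖ = x.2.1 := by
  have hr : (0 : ℝ) < x.2.1 := x.2.1.2
  simp [polarMap, norm_smul, abs_of_pos hr]

/-- A radial function is integrable if its profile is. -/
theorem integrable_radialFun (hn : 0 < n) {G : ℝ → ℝ → ℂ}
    (hG : Integrable (fun x : Set.Ioi (0 : ℝ) × ℝ => G x.1 x.2) (radialMeasure (2 * n - 1))) :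
    Integrable (radialFun n G) := by
  rw [← (measurePreserving_polarMap hn).integrable_comp_emb (measurableEmbedding_polarMap n)]
  refine (Integrable.comp_snd hG _).congr (Filter.Eventually.of_forall fun x => ?_)
  simp only [Function.comp_apply, radialFun, polarMap_fst_norm]
  rfl

theorem integral_radialFun (hn : 0 < n) (G : ℝ → ℝ → ℂ) :
    ∫ x, radialFun n G x = 2 * (Real.pi : ℂ) ^ n / (n - 1).factorial *
      ∫ x, G x.1 x.2 ∂(radialMeasure (2 * n - 1)) := by
  rw [← (measurePreserving_polarMap hn).integral_comp (measurableEmbedding_polarMap n)]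
  simp only [radialFun, polarMap_fst_norm]
  have := integral_fun_snd (μ := (volume : Measure (EuclideanSpace ℂ (Fin n))).toSphere)
    (ν := radialMeasure (2 * n - 1)) (fun x : Set.Ioi (0 : ℝ) × ℝ => G x.1 x.2)
  rw [Complex.real_smul, toSphere_real_univ hn] at this
  exact this

/-- If `P g` is integrable on `Heis n` with `g` radial and `P ≠ 0` homogeneous of degree `N`, then
`r^N g` is integrable. -/
theorem integrable_profile (hn : 0 < n) {N : ℕ} {P : EuclideanSpace ℂ (Fin n) → ℂ}
    (hP : ∀ (r : ℝ) w, P (r • w) = (r : ℂ) ^ N * P w) (hP0 : P ≠ 0)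
    {g : ℝ → ℝ → ℂ} (hg : Integrable fun x : Heis n => P x.1 * radialFun n g x)
    (hPc : Continuous P) :
    Integrable (fun x : Set.Ioi (0 : ℝ) × ℝ => ((x.1 : ℝ) : ℂ) ^ N * g x.1 x.2)
      (radialMeasure (2 * n - 1)) := by
  have : Nonempty (Fin n) := ⟨⟨0, hn⟩⟩
  rw [← (measurePreserving_polarMap hn).integrable_comp_emb (measurableEmbedding_polarMap n)] at hg
  have hae := Integrable.prod_right_ae hg
  obtain ⟨ω₀, hω₀⟩ : ∃ ω : Metric.sphere (0 : EuclideanSpace ℂ (Fin n)) 1, P ω ≠ 0 := by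
    obtain ⟨z, hz⟩ : ∃ z, P z ≠ 0 := by
      by_contra! h
      exact hP0 (funext h)
    have hex : ∃ (r : ℝ) (ω : Metric.sphere (0 : EuclideanSpace ℂ (Fin n)) 1),
        z = r • (ω : EuclideanSpace ℂ (Fin n)) := by
      by_cases h0 : z = 0
      · obtain ⟨ω⟩ : Nonempty (Metric.sphere (0 : EuclideanSpace ℂ (Fin n)) 1) :=
          (NormedSpace.sphere_nonempty.mpr zero_le_one).to_subtype
        exact ⟨0, ω, by simp [h0]⟩
      · have h1 : ‖z‖ ≠ 0 := norm_ne_zero_iff.mpr h0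
        refine ⟨‖z‖, ⟨‖z‖⁻¹ • z, by simp [norm_smul, h1]⟩, ?_⟩
        simp [smul_smul, h1]
    obtain ⟨r, ω, rfl⟩ := hex
    refine ⟨ω, fun h => hz ?_⟩
    rw [hP, h, mul_zero]
  -- Fubini gives an integrable slice for almost every `ω`. Such `ω` are dense, so one of them lies
  -- in the nonempty open set where `P ω ≠ 0`, and dividing by `P ω` is allowed.
  have hopen : IsOpen {ω : Metric.sphere (0 : EuclideanSpace ℂ (Fin n)) 1 | P ω ≠ 0} :=
    isOpen_ne_fun (by fun_prop) continuous_const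
  obtain ⟨ω, hω, hint⟩ := (Measure.dense_of_ae hae).inter_open_nonempty _ hopen ⟨ω₀, hω₀⟩
  refine ((Set.mem_ofPred_eq ▸ hint : Integrable _ _).const_mul (P ω)⁻¹).congr
    (Filter.Eventually.of_forall fun x => ?_)
  have hω' : P ω ≠ 0 := hω
  simp only [Function.comp_apply, radialFun, polarMap_fst_norm]
  simp only [polarMap, hP]
  field_simp

/-- The extra weight `r^{2N}` is split evenly: one `r^N` makes `g` integrable, the other is absorbed
by the bounded function `r^N e_{k,λ}^d`. -/
theorem integrable_profile_mul_laguerreE (hn : 0 < n) {N : ℕ} {g : ℝ → ℝ → ℂ}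
    (hg : Integrable (fun x : Set.Ioi (0 : ℝ) × ℝ => ((x.1 : ℝ) : ℂ) ^ N * g x.1 x.2)
      (radialMeasure (2 * n - 1))) (d : ℕ) (k : ℤ) {lam : ℝ} (hlam : lam ≠ 0) :
    Integrable (fun x : Set.Ioi (0 : ℝ) × ℝ => g x.1 x.2 * laguerreE d k lam x.1 (-x.2))
      (radialMeasure (2 * (n + N) - 1)) := by
  rw [show 2 * (n + N) - 1 = 2 * n - 1 + 2 * N by omega, integrable_radialMeasure_add_iff]
  obtain ⟨C, hC⟩ := exists_pow_mul_laguerreE_le d k N hlam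
  have hcont : Continuous fun x : Set.Ioi (0 : ℝ) × ℝ =>
      ((x.1 : ℝ) : ℂ) ^ N * laguerreE d k lam x.1 (-x.2) := by
    have := continuous_laguerreE d k lam
    have h2 : Continuous fun x : Set.Ioi (0 : ℝ) × ℝ => laguerreE d k lam x.1 (-x.2) :=
      this.comp (f := fun x : Set.Ioi (0 : ℝ) × ℝ => ((x.1 : ℝ), -x.2)) (by fun_prop)
    fun_prop
  have := hg.mul_bdd (c := C) hcont.aestronglyMeasurable (Filter.Eventually.of_forall fun x => by
    have hr : (0 : ℝ) < x.1 := x.1.2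
    rw [norm_mul, norm_pow, Complex.norm_real, Real.norm_eq_abs, abs_of_pos hr]
    exact hC _ _ hr.le)
  refine this.congr (Filter.Eventually.of_forall fun x => ?_)
  simp only
  ring

theorem radialFun_mul_sphericalE_heisInv {m K : ℕ} (g : ℝ → ℝ → ℂ) {a : ℝ × ℝ}
    (h0 : a.1 ≠ 0) (ha : a ∈ fanRay m K) :
    (fun x : Heis m => radialFun m g x * sphericalE m a (heisInv x)) =
      radialFun m fun r t => ((K.factorial * (m - 1).factorial : ℂ) /
        (K + m - 1).factorial) * (g r t * laguerreE (m - 1) K a.1 r (-t)) := by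
  funext x
  simp only [radialFun, sphericalE, fanE, fanIndex_of_mem h0 ha, Int.toNat_natCast, heisInv,
    norm_neg]
  ring

/-- Off the fan, `fanIndex` takes its default value `-1`, for which the Laguerre function is zero.
This covers the case `k < q`. -/
theorem sphericalE_eq_zero_of_forall_notMem {m : ℕ} {a : ℝ × ℝ} (ha : ∀ K, a ∉ fanRay m K)
    (x : Heis m) : sphericalE m a x = 0 := by
  have : fanIndex m a = -1 := by
    unfold fanIndex
    rw [dif_neg (by simpa using ha)]
  simp [sphericalE, fanE, this, laguerreE, laguerrePhi]

theorem fanShift_mem_fanRay {n k p q : ℕ} (hqk : q ≤ k) (lam : ℝ) :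
    fanShift n k p q lam ∈ fanRay (n + p + q) (k - q) := by
  simp only [fanShift, fanRay, Set.mem_ofPred_eq]
  push_cast [Nat.cast_sub hqk]
  ring

theorem fanShift_notMem_fanRay {n k p q : ℕ} (hqk : k < q) {lam : ℝ} (hlam : lam ≠ 0) (K : ℕ) :
    fanShift n k p q lam ∉ fanRay (n + p + q) K := by
  simp only [fanShift, fanRay, Set.mem_ofPred_eq]
  intro h
  have h1 := mul_right_cancel₀ (abs_pos.mpr hlam).ne' h
  have h2 : (k : ℝ) < q := by exact_mod_cast hqk
  push_cast at h1
  have := Nat.cast_nonneg (α := ℝ) K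
  linarith

theorem exists_norm_heisMul_kernel_le {a : ℝ × ℝ} (ha : a.1 ≠ 0)
    (z : EuclideanSpace ℂ (Fin n)) :
    ∃ C, ∀ x : Heis n, ‖fanE n a (heisMul (heisInv x) (z, 0))‖ ≤ C := by
  obtain ⟨C, hC⟩ := exists_pow_mul_laguerreE_le (n - 1) (fanIndex n a) 0 ha
  refine ⟨C, fun x => ?_⟩
  have := hC ‖(heisMul (heisInv x) (z, 0)).1‖ (heisMul (heisInv x) (z, 0)).2 (norm_nonneg _)
  rwa [pow_zero, one_mul] at this

theorem continuous_heisMul_kernel (a : ℝ × ℝ) (z : EuclideanSpace ℂ (Fin n)) :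
    Continuous fun x : Heis n => fanE n a (heisMul (heisInv x) (z, 0)) := by
  refine (continuous_laguerreE (n - 1) (fanIndex n a) a.1).comp
    (f := fun x : Heis n => (‖(heisMul (heisInv x) (z, 0)).1‖, (heisMul (heisInv x) (z, 0)).2)) ?_
  simp only [heisMul, heisInv]
  have : Continuous fun x : Heis n => ∑ j, (-x.1) j * (starRingEnd ℂ) (z j) := by
    simp only [PiLp.neg_apply]
    fun_prop
  have := Complex.continuous_im.comp this
  simp only [Function.comp_def] at this
  fun_prop

end

/-! ### Assembly of the Hecke–Bochner formula -/

theorem laguerreE_natCast (d K : ℕ) (lam r t : ℝ) :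
    laguerreE d (K : ℤ) lam r t = Complex.exp (Complex.I * lam * t) *
      (laguerreSum (K + d) d ((|lam| / 2 * r ^ 2 : ℝ) : ℂ) *
        (Real.exp (-(1 / 4) * |lam| * r ^ 2) : ℂ)) := by
  rw [laguerreE, laguerrePhi, if_pos (Int.natCast_nonneg K), Int.toNat_natCast,
    Complex.ofReal_mul, ofReal_laguerreL, show 1 / 2 * |lam| * r ^ 2 = |lam| / 2 * r ^ 2 by ring]

section

variable {n : ℕ}

theorem strichartzFT_eq_integral_radialMeasure (hn : 0 < n) {P : EuclideanSpace ℂ (Fin n) → ℂ}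
    {g : ℝ → ℝ → ℂ} {f : Heis n → ℂ} (hf : Integrable f)
    (hfg : ∀ᵐ x : Heis n, f x = P x.1 * radialFun n g x) {a : ℝ × ℝ} (ha : a.1 ≠ 0)
    (z : EuclideanSpace ℂ (Fin n)) :
    strichartzFT n f a z = ∫ y, ∫ ω : Metric.sphere (0 : EuclideanSpace ℂ (Fin n)) 1,
      P ((y.1 : ℝ) • (ω : EuclideanSpace ℂ (Fin n))) * g y.1 y.2 *
        fanE n a (heisMul (heisInv ((y.1 : ℝ) • (ω : EuclideanSpace ℂ (Fin n)), y.2)) (z, 0))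
      ∂(volume : Measure (EuclideanSpace ℂ (Fin n))).toSphere ∂(radialMeasure (2 * n - 1)) := by
  obtain ⟨C, hC⟩ := exists_norm_heisMul_kernel_le ha z
  have h1 : strichartzFT n f a z = ∫ x : Heis n,
      P x.1 * radialFun n g x * fanE n a (heisMul (heisInv x) (z, 0)) := by
    rw [strichartzFT]
    refine integral_congr_ae ?_
    filter_upwards [hfg] with x hx
    rw [hx]
  have h2 : Integrable fun x : Heis n =>
      P x.1 * radialFun n g x * fanE n a (heisMul (heisInv x) (z, 0)) :=
    (hf.congr hfg).mul_bdd (c := C) (continuous_heisMul_kernel a z).aestronglyMeasurable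
      (Filter.Eventually.of_forall hC)
  rw [← (measurePreserving_polarMap hn).integrable_comp_emb (measurableEmbedding_polarMap n)] at h2
  rw [h1, ← (measurePreserving_polarMap hn).integral_comp (measurableEmbedding_polarMap n)]
  refine (integral_prod_symm _ h2).trans ?_
  refine integral_congr_ae (Filter.Eventually.of_forall fun y => ?_)
  refine integral_congr_ae (Filter.Eventually.of_forall fun ω => ?_)
  simp only [Function.comp_apply, radialFun, polarMap_fst_norm]
  simp only [polarMap]

/-- The Hecke–Bochner formula for a function `P` which has the moments of a bigraded solid
harmonic with respect to `A` and `B`. -/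
theorem strichartzFT_eq_of_moments {m k p q : ℕ} (hn : 0 < n) (hm : m = n + p + q)
    {P A B : EuclideanSpace ℂ (Fin n) → ℂ} (hPc : Continuous P) (hA : Continuous A)
    (hB : Continuous B) (hP : ∀ (r : ℝ) w, P (r • w) = (r : ℂ) ^ (p + q) * P w)
    (hAr : ∀ (r : ℝ) w, A (r • w) = (r : ℂ) * A w) (hBr : ∀ (r : ℝ) w, B (r • w) = (r : ℂ) * B w)
    {g : ℝ → ℝ → ℂ} {f : Heis n → ℂ} (hf : Integrable f)
    (hfg : ∀ᵐ x : Heis n, f x = P x.1 * radialFun n g x) {lam : ℝ} (hlam : lam ≠ 0)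
    (z : EuclideanSpace ℂ (Fin n))
    (hAB : ∀ w, A w + B w = polyFun (holLin z) w + polyFun (antiholLin z) w)
    (hBif : ∀ w, B w = if 0 < lam then polyFun (antiholLin z) w else polyFun (holLin z) w)
    (hz : ∀ a b, (¬ ∃ j, a = q + j ∧ b = p + j) →
      ∫ ω : Metric.sphere (0 : EuclideanSpace ℂ (Fin n)) 1, P ω * A ω ^ a * B ω ^ b
        ∂(volume : Measure (EuclideanSpace ℂ (Fin n))).toSphere = 0)
    (hc : ∀ j, ∫ ω : Metric.sphere (0 : EuclideanSpace ℂ (Fin n)) 1,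
        P ω * A ω ^ (q + j) * B ω ^ (p + j)
        ∂(volume : Measure (EuclideanSpace ℂ (Fin n))).toSphere =
      (q + j).factorial * (p + j).factorial * (2 * (Real.pi : ℂ) ^ n *
      (((‖z‖ ^ 2 : ℝ) : ℂ) ^ j / (j.factorial * (n + p + q - 1 + j).factorial)) * P z)) :
    strichartzFT n f (lam, (2 * (k : ℝ) + (n : ℝ)) * |lam|) z =
      ((2 * (Real.pi : ℂ)) ^ (p + q))⁻¹ * ((|lam| : ℝ) : ℂ) ^ (p + q) * P z *
        gelfandT m (radialFun m g) (fanShift n k p q lam) *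
        laguerreE (m - 1) ((k : ℤ) - (q : ℤ)) lam ‖z‖ 0 := by
  -- The dimension `m` is kept free up to this point so that `p` and `q` can be exchanged, `n + p +
  -- q` and `n + q + p` not being definitionally equal.
  subst hm
  have hpi : (Real.pi : ℂ) ≠ 0 := Complex.ofReal_ne_zero.mpr Real.pi_ne_zero
  set d := n + p + q - 1 with hd
  set κ : ℝ := |lam| / 2 with hκ
  have hinner : ∀ y : Set.Ioi (0 : ℝ) × ℝ,
      ∫ ω : Metric.sphere (0 : EuclideanSpace ℂ (Fin n)) 1,
      P ((y.1 : ℝ) • (ω : EuclideanSpace ℂ (Fin n))) * g y.1 y.2 *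
        fanE n (lam, (2 * (k : ℝ) + (n : ℝ)) * |lam|)
          (heisMul (heisInv ((y.1 : ℝ) • (ω : EuclideanSpace ℂ (Fin n)), y.2)) (z, 0))
      ∂(volume : Measure (EuclideanSpace ℂ (Fin n))).toSphere =
      ((y.1 : ℝ) : ℂ) ^ (p + q) * g y.1 y.2 *
        (Complex.exp (Complex.I * lam * ((-y.2 : ℝ) : ℂ)) *
          (Real.exp (-(1 / 4) * |lam| * (‖z‖ ^ 2 + (y.1 : ℝ) ^ 2)) : ℂ)) *
      (2 * (Real.pi : ℂ) ^ n * P z * (κ * (y.1 : ℝ)) ^ (p + q) *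
        if q ≤ k then ((k - q).factorial : ℂ) / (k - q + d).factorial *
          laguerreSum (k - q + d) d ((κ * ‖z‖ ^ 2 : ℝ) : ℂ) *
          laguerreSum (k - q + d) d ((κ * (y.1 : ℝ) ^ 2 : ℝ) : ℂ)
        else 0) := by
    intro y
    have hr : (0 : ℝ) < y.1 := y.1.2
    rw [← integral_sphere_mul_exp_mul_laguerreSum hn hPc hA hB z κ y.1 hz hc,
      ← integral_const_mul]
    refine integral_congr_ae (Filter.Eventually.of_forall fun ω => ?_)
    have hω : ‖(y.1 : ℝ) • (ω : EuclideanSpace ℂ (Fin n))‖ = y.1 := by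
      simp [norm_smul, abs_of_pos hr]
    simp only
    have hAB' := hAB ((y.1 : ℝ) • (ω : EuclideanSpace ℂ (Fin n)))
    rw [hAr, hBr] at hAB'
    have harg : ((κ * (‖z‖ ^ 2 + (y.1 : ℝ) ^ 2) : ℝ) : ℂ) -
        κ * polyFun (holLin z) ((y.1 : ℝ) • (ω : EuclideanSpace ℂ (Fin n))) -
        κ * polyFun (antiholLin z) ((y.1 : ℝ) • (ω : EuclideanSpace ℂ (Fin n))) =
        ((κ * (‖z‖ ^ 2 + (y.1 : ℝ) ^ 2) : ℝ) : ℂ) - κ * ((y.1 : ℝ) * A ω) -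
          κ * ((y.1 : ℝ) * B ω) := by
      linear_combination (κ : ℂ) * hAB'
    rw [fanE_heisMul_heisInv hlam, hω, ← hBif, ← hκ, harg, hP, hBr]
    ring
  rw [strichartzFT_eq_integral_radialMeasure hn hf hfg hlam]
  simp_rw [hinner]
  by_cases hqk : q ≤ k
  · have hK : (k : ℤ) - q = ((k - q : ℕ) : ℤ) := by omega
    rw [gelfandT, radialFun_mul_sphericalE_heisInv g hlam (fanShift_mem_fanRay hqk lam),
      integral_radialFun (by omega), show 2 * (n + p + q) - 1 = 2 * n - 1 + 2 * (p + q) by omega,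
      integral_radialMeasure_add, hK, laguerreE_natCast]
    simp_rw [if_pos hqk]
    have hcalc : ∀ y : Set.Ioi (0 : ℝ) × ℝ,
      ((y.1 : ℝ) : ℂ) ^ (p + q) * g y.1 y.2 *
        (Complex.exp (Complex.I * lam * ((-y.2 : ℝ) : ℂ)) *
          (Real.exp (-(1 / 4) * |lam| * (‖z‖ ^ 2 + (y.1 : ℝ) ^ 2)) : ℂ)) *
      (2 * (Real.pi : ℂ) ^ n * P z * (κ * (y.1 : ℝ)) ^ (p + q) *
        (((k - q).factorial : ℂ) / (k - q + d).factorial *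
          laguerreSum (k - q + d) d ((κ * ‖z‖ ^ 2 : ℝ) : ℂ) *
          laguerreSum (k - q + d) d ((κ * (y.1 : ℝ) ^ 2 : ℝ) : ℂ))) =
      (2 * (Real.pi : ℂ) ^ n * P z * (κ : ℂ) ^ (p + q) / d.factorial *
        (laguerreSum (k - q + d) d ((κ * ‖z‖ ^ 2 : ℝ) : ℂ) *
          (Real.exp (-(1 / 4) * |lam| * ‖z‖ ^ 2) : ℂ))) *
      (((y.1 : ℝ) : ℂ) ^ (2 * (p + q)) * (((k - q).factorial * d.factorial : ℂ) /
        (k - q + (n + p + q) - 1).factorial *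
          (g y.1 y.2 * laguerreE d ((k - q : ℕ) : ℤ) lam y.1 (-y.2)))) := by
      intro y
      rw [laguerreE_natCast, mul_add, Real.exp_add, ← hκ,
        show k - q + (n + p + q) - 1 = k - q + d by omega]
      have := Nat.cast_ne_zero (R := ℂ).mpr d.factorial_ne_zero
      have := Nat.cast_ne_zero (R := ℂ).mpr (k - q + d).factorial_ne_zero
      rw [mul_pow, two_mul (p + q), pow_add, Complex.ofReal_mul (Real.exp _)]
      field_simp
      ring
    simp_rw [hcalc]
    rw [integral_const_mul, ← hκ, ← hd]
    set I : ℂ := ∫ y : Set.Ioi (0 : ℝ) × ℝ, ((y.1 : ℝ) : ℂ) ^ (2 * (p + q)) *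
      (((k - q).factorial * d.factorial : ℂ) / (k - q + (n + p + q) - 1).factorial *
        (g y.1 y.2 * laguerreE d ((k - q : ℕ) : ℤ) lam y.1 (-y.2))) ∂(radialMeasure (2 * n - 1))
    change _ * I = _ * P z * (_ * I) * _
    have hκ2 : (κ : ℂ) ^ (p + q) = ((|lam| : ℝ) : ℂ) ^ (p + q) / 2 ^ (p + q) := by
      rw [hκ, ← div_pow]; push_cast; rfl
    -- The constant `(2π)^{-(p+q)}` arises from `κ^{p+q} = (|λ|/2)^{p+q}` and from the powers `π^n`
    -- and `π^{n+p+q}` in the sphere integrals of the two dimensions.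
    rw [hκ2, show n + p + q = n + (p + q) by omega, pow_add _ n (p + q), mul_pow]
    have e0 : Complex.exp (Complex.I * lam * ((0 : ℝ) : ℂ)) = 1 := by simp
    rw [e0]
    field_simp
  · simp_rw [if_neg hqk, mul_zero, integral_zero]
    rw [laguerreE, laguerrePhi, if_neg (by omega)]
    simp

theorem integrable_radialFun_mul_sphericalE_heisInv {m k p q : ℕ} (hn : 0 < n)
    (hm : m = n + p + q) {P : EuclideanSpace ℂ (Fin n) → ℂ}
    (hP : ∀ (r : ℝ) w, P (r • w) = (r : ℂ) ^ (p + q) * P w) (hP0 : P ≠ 0) (hPc : Continuous P)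
    {g : ℝ → ℝ → ℂ} (hg : Integrable fun x : Heis n => P x.1 * radialFun n g x)
    {lam : ℝ} (hlam : lam ≠ 0) :
    Integrable fun x : Heis m =>
      radialFun m g x * sphericalE m (fanShift n k p q lam) (heisInv x) := by
  subst hm
  rcases le_or_gt q k with hqk | hqk
  · rw [radialFun_mul_sphericalE_heisInv g hlam (fanShift_mem_fanRay hqk lam)]
    refine integrable_radialFun (by omega) (Integrable.const_mul ?_ _)
    rw [add_assoc]
    exact integrable_profile_mul_laguerreE hn (integrable_profile hn hP hP0 hg hPc) _ _ hlam
  · simp_rw [sphericalE_eq_zero_of_forall_notMem (fanShift_notMem_fanRay hqk hlam), mul_zero]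
    exact integrable_zero _ _ _

end

theorem corollary3p2 (n p q : ℕ) (hn : 0 < n)
    (P : EuclideanSpace ℂ (Fin n) → ℂ) (hP : IsSolidHarmonic p q P)
    (g : ℝ → ℝ → ℂ) (f : Heis n → ℂ) (hf : Integrable f)
    (hfg : ∀ᵐ x : Heis n, f x = P x.1 * radialFun n g x)
    (k : ℕ) (lam : ℝ) (a : ℝ × ℝ) (ha : a = (lam, (2 * (k : ℝ) + (n : ℝ)) * |lam|)) :
    (0 < lam →
      (P ≠ 0 → Integrable (fun x : Heis (n + p + q) =>
        radialFun (n + p + q) g x *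
          sphericalE (n + p + q) (fanShift n k p q lam) (heisInv x))) ∧
      ∀ z : EuclideanSpace ℂ (Fin n),
        strichartzFT n f a z =
          ((2 * (Real.pi : ℂ)) ^ (p + q))⁻¹ * ((|lam| : ℝ) : ℂ) ^ (p + q) * P z *
            gelfandT (n + p + q) (radialFun (n + p + q) g) (fanShift n k p q lam) *
            laguerreE (n + p + q - 1) ((k : ℤ) - (q : ℤ)) lam ‖z‖ 0) ∧
    (lam < 0 →
      (P ≠ 0 → Integrable (fun x : Heis (n + p + q) =>
        radialFun (n + p + q) g x *
          sphericalE (n + p + q) (fanShift n k q p lam) (heisInv x))) ∧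
      ∀ z : EuclideanSpace ℂ (Fin n),
        strichartzFT n f a z =
          ((2 * (Real.pi : ℂ)) ^ (p + q))⁻¹ * ((|lam| : ℝ) : ℂ) ^ (p + q) * P z *
            gelfandT (n + p + q) (radialFun (n + p + q) g) (fanShift n k q p lam) *
            laguerreE (n + p + q - 1) ((k : ℤ) - (p : ℤ)) lam ‖z‖ 0) := by
  subst ha
  obtain ⟨h, hpq, hharm, rfl⟩ := hP.exists_polyFun
  have hPc := continuous_polyFun h
  have hint := hf.congr hfg
  have hscale := hpq.polyFun_smul_real
  refine ⟨fun hlam => ⟨fun hP0 => ?_, fun z => ?_⟩, fun hlam => ⟨fun hP0 => ?_, fun z => ?_⟩⟩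
  · exact integrable_radialFun_mul_sphericalE_heisInv hn rfl hscale hP0 hPc hint hlam.ne'
  · exact strichartzFT_eq_of_moments hn rfl hPc (continuous_polyFun (holLin z))
      (continuous_polyFun (antiholLin z)) hscale (fun r w => polyFun_holLin_smul z w r)
      (fun r w => polyFun_antiholLin_smul z w r) hf hfg hlam.ne' z (fun w => rfl)
      (fun w => by rw [if_pos hlam]) (fun a b => hharm.integral_sphere_eq_zero hn hpq z)
      (hharm.integral_sphere_eq hn hpq z)
  · rw [add_comm p q] at hscale
    exact integrable_radialFun_mul_sphericalE_heisInv hn (add_right_comm n p q) hscale hP0 hPc hint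
      hlam.ne
  -- For `λ < 0` the formula is applied with `w · z̄` and `w̄ · z` exchanged and with `(q, p)` in
  -- place of `(p, q)`.
  · rw [add_comm p q] at hscale ⊢
    refine strichartzFT_eq_of_moments hn (add_right_comm n p q) hPc
      (continuous_polyFun (antiholLin z)) (continuous_polyFun (holLin z)) hscale
      (fun r w => polyFun_antiholLin_smul z w r) (fun r w => polyFun_holLin_smul z w r) hf hfg
      hlam.ne z (fun w => add_comm _ _) (fun w => by rw [if_neg (not_lt.mpr hlam.le)])
      (fun a b hab => ?_) (fun j => ?_)
    · rw [← hharm.integral_sphere_eq_zero hn hpq z (a := b) (b := a)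
        (fun ⟨j, h1, h2⟩ => hab ⟨j, h2, h1⟩)]
      refine integral_congr_ae (Filter.Eventually.of_forall fun ω => ?_)
      exact mul_right_comm _ _ _
    · refine (integral_congr_ae (Filter.Eventually.of_forall fun ω =>
        mul_right_comm _ _ _)).trans ?_
      rw [hharm.integral_sphere_eq hn hpq z j, add_right_comm n p q]
      ring
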